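/- Let $\mathcal T=(\mathcal V,\mathcal E)$ be a finite tree with $d\ge 1$ vertices, let $q\in(0,1)$, and let $\boldsymbol\alpha=(\alpha_e,\ e\in\mathcal E)\in(0,1)^{d-1}$. Let $\boldsymbol J=(J_v,\ v\in\mathcal V)$ follow an Ising model defined on $\mathcal T$ with mean parameters $q\boldsymbol 1_d$ and $\boldsymbol\alpha$. That is, there are real numbers $\eta_v$ $(v\in\mathcal V)$ and $\eta_{\{u,v\}}\neq 0$ $((u,v)\in\mathcal E)$ such that, $A(\boldsymbol\eta)$ being the normalizing constant, $$\Pr(\boldsymbol J=\boldsymbol x)=\exp\Big(\sum_{v\in\mathcal V}\eta_v x_v+\sum_{(u,v)\in\mathcal E}\eta_{\{u,v\}}x_ux_v-A(\boldsymbol\eta)\Big),\qquad \boldsymbol x\in\{0,1\}^{\mathcal V},$$ and $\mathrm E[J_v]=q$ for every $v\in\mathcal V$, and the Pearson correlation coefficient of $J_u$ and $J_v$ is $\alpha_{(u,v)}$ for every edge $(u,v)\in\mathcal E$. Let $\boldsymbol N=(N_v,\ v\in\mathcal V)\sim\mathrm{MPMRF}(q,\boldsymbol\alpha,\mathcal T)$.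 That is, for some choice of a root $r\in\mathcal V$, the vector $\boldsymbol N$ has the law of the vector defined by $$N_r=L_r,\qquad N_v=\sum_{i=1}^{N_{\mathrm{pa}(v)}} I_{v,i}+L_v\quad (v\in\mathcal V\setminus\{r\}),$$ where $\mathrm{pa}(v)$ is the parent of $v$ in $\mathcal T$ rooted at $r$, $L_r$ is Poisson with mean $q$, $L_v$ is Poisson with mean $q(1-\alpha_{(\mathrm{pa}(v),v)})$ for $v\ne r$, each $I_{v,i}$ is Bernoulli with success probability $\alpha_{(\mathrm{pa}(v),v)}$, and all the variables $L_v$ and $I_{v,i}$ are mutually independent. Then $K=\sum_{v\in\mathcal V}J_v$ is dominated in the convex order by $M=\sum_{v\in\mathcal V}N_v$, written $K\preceq_{\mathrm{cx}}M$: for every convex function $\varphi:\mathbb R\to\mathbb R$ such that both expectations are well-defined (as elements of $[-\infty,\infty]$), $\mathrm E[\varphi(K)]\le\mathrm E[\varphi(M)]$. -/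

import Mathlib

open MeasureTheory ProbabilityTheory

noncomputable section

namespace IsingPoisson

/-! ### Tree-structured Ising models -/

section Ising

variable {V : Type*} [Fintype V]

/-- The energy `∑_v η_v x_v + ∑_{(u,v) ∈ E} η_{u,v} x_u x_v` of a configuration `x ∈ {0,1}^V`, where
`η₁` are the natural parameters of first order and `η₂` those of second order. -/
def energy (G : SimpleGraph V) [Fintype G.edgeSet] (η₁ : V → ℝ) (η₂ : Sym2 V → ℝ)
    (x : V → Fin 2) : ℝ :=
  ∑ v, η₁ v * ((x v : ℕ) : ℝ) +
    ∑ e ∈ G.edgeFinset, η₂ e * (e.map fun v => ((x v : ℕ) : ℝ)).mul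

/-- The normalizing constant `A(η)`. -/
def logPartition [DecidableEq V] (G : SimpleGraph V) [Fintype G.edgeSet] (η₁ : V → ℝ)
    (η₂ : Sym2 V → ℝ) : ℝ :=
  Real.log (∑ x : V → Fin 2, Real.exp (energy G η₁ η₂ x))

/-- The random vector `J` follows an Ising model defined on the graph `G`: its joint probability
mass function is `exp (∑ η_v x_v + ∑ η_{u,v} x_u x_v - A(η))` on `{0,1}^V` for some real natural
parameters. The second order parameters are non-zero on the edges of `G`; those of the other pairs
and all parameters of higher order are zero, that is, they do not occur in the energy. -/
structure IsIsing [DecidableEq V] (G : SimpleGraph V) [Fintype G.edgeSet]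
    {Ω : Type*} [MeasurableSpace Ω] (P : Measure Ω) (J : V → Ω → ℕ) : Prop where
  measurable : ∀ v, Measurable (J v)
  pmf : ∃ (η₁ : V → ℝ) (η₂ : Sym2 V → ℝ), (∀ e ∈ G.edgeSet, η₂ e ≠ 0) ∧
    ∀ x : V → Fin 2, P.real {ω | ∀ v, J v ω = (x v : ℕ)} =
      Real.exp (energy G η₁ η₂ x - logPartition G η₁ η₂)

/-- Pearson's correlation coefficient. -/
def pearsonCorr {Ω : Type*} [MeasurableSpace Ω] (X Y : Ω → ℝ) (P : Measure Ω) : ℝ :=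
  cov[X, Y; P] / √(Var[X; P] * Var[Y; P])

/-- The mean parameters of `J` are `q` and `α`: `q v = E[J_v]` for every vertex `v` and
`α_{u,v} = Corr(J_u, J_v)` for every edge `(u,v)`. -/
structure HasMeanParams (G : SimpleGraph V)
    {Ω : Type*} [MeasurableSpace Ω] (P : Measure Ω) (J : V → Ω → ℕ)
    (q : V → ℝ) (α : Sym2 V → ℝ) : Prop where
  mean : ∀ v, ∫ ω, (J v ω : ℝ) ∂P = q v
  corr : ∀ u v, G.Adj u v →
    pearsonCorr (fun ω => (J u ω : ℝ)) (fun ω => (J v ω : ℝ)) P = α s(u, v)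

end Ising

/-! ### The Markov random fields with Poisson marginals -/

section MPMRF

variable {V : Type*}

/-- In the tree `G` rooted at `r`, the vertex `w` is the parent of `v`: it is the neighbour of `v`
that lies on the path from `r` to `v`. -/
def IsParent (G : SimpleGraph V) (r w v : V) : Prop :=
  G.Adj w v ∧ ∃ p : G.Walk r v, p.IsPath ∧ w ∈ p.support

/-- In a tree rooted at `r`, every vertex other than `r` has exactly one parent. -/
theorem existsUnique_isParent {G : SimpleGraph V} (hG : G.IsTree) {r v : V} (hv : v ≠ r) :
    ∃! w, IsParent G r w v := by
  obtain ⟨p, hp, -⟩ := hG.existsUnique_path r v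
  have hnil : ¬ p.Nil := fun h => hv h.eq.symm
  refine ⟨p.penultimate, ⟨p.adj_penultimate hnil, p, hp, ?_⟩, ?_⟩
  · exact p.getVert_mem_support _
  · rintro w ⟨hadj, p', hp', hw⟩
    obtain rfl : p = p' := (hG.existsUnique_path r v).unique hp hp'
    exact hG.isAcyclic.eq_penultimate_of_adj_end hp hadj.symm hw

/-- In a tree rooted at `r`, the root `r` has no parent. -/
theorem not_isParent_root {G : SimpleGraph V} (r w : V) : ¬ IsParent G r w r := by
  rintro ⟨hadj, p, hp, hw⟩
  have h := (SimpleGraph.Walk.isPath_iff_nil.1 hp).eq_nil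
  rw [h, SimpleGraph.Walk.support_nil, List.mem_singleton] at hw
  exact hadj.ne hw

/-- The binomial thinning `∑_{i=1}^X I_i` of `X` by the trials `I`. -/
def thinning {Ω : Type*} (I : ℕ → Ω → ℕ) (X : Ω → ℕ) (ω : Ω) : ℕ :=
  ∑ i ∈ Finset.range (X ω), I i ω

/-- The stochastic representation on the tree `G` rooted at `r`:
`N_r = L_r` and `N_v = α_{(pa(v),v)} ∘ N_{pa(v)} + L_v` for `v ≠ r`, where the `L_v` are Poisson
variables, of mean `lam` at the root and `lam * (1 - α_{(pa(v),v)})` elsewhere, the trials `I v i`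
are Bernoulli variables of success probability `α_{(pa(v),v)}`, and all the `L_v` and `I v i` are
mutually independent. -/
structure IsMPMRFRepr (G : SimpleGraph V) (r : V) (lam : ℝ) (α : Sym2 V → ℝ)
    {Ω : Type*} [MeasurableSpace Ω] (P : Measure Ω)
    (N L : V → Ω → ℕ) (I : V → ℕ → Ω → ℕ) : Prop where
  measurable_L : ∀ v, Measurable (L v)
  measurable_I : ∀ v i, Measurable (I v i)
  law_L_root : P.map (L r) = poissonMeasure lam.toNNReal
  law_L : ∀ w v, IsParent G r w v →
    P.map (L v) = poissonMeasure (lam * (1 - α s(w, v))).toNNReal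
  law_I : ∀ w v, IsParent G r w v → ∀ i,
    P.real {ω | I v i ω = 1} = α s(w, v) ∧ P.real {ω | I v i ω = 0} = 1 - α s(w, v)
  indep : iIndepFun
    (fun k : V ⊕ V × ℕ => Sum.elim L (fun p : V × ℕ => I p.1 p.2) k) P
  root : ∀ ω, N r ω = L r ω
  step : ∀ w v, IsParent G r w v → ∀ ω, N v ω = thinning (I v) (N w) ω + L v ω

/-- `N ∼ MPMRF(lam, α, G)`: for some choice of a root, the random vector `N` has the law of a vector
given by the stochastic representation. -/
def IsMPMRF (G : SimpleGraph V) (lam : ℝ) (α : Sym2 V → ℝ)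
    {Ω : Type*} [MeasurableSpace Ω] (P : Measure Ω) (N : V → Ω → ℕ) : Prop :=
  ∃ (r : V) (Ω₀ : Type) (_ : MeasurableSpace Ω₀) (P₀ : Measure Ω₀) (_ : IsProbabilityMeasure P₀)
    (N₀ L : V → Ω₀ → ℕ) (I : V → ℕ → Ω₀ → ℕ),
    IsMPMRFRepr G r lam α P₀ N₀ L I ∧
      IdentDistrib (fun ω v => N v ω) (fun ω v => N₀ v ω) P P₀

end MPMRF

/-! ### The convex order -/

section ConvexOrder

/-- The expectation of `f` is well-defined in `[-∞, ∞]`: the positive part and the negative part do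
not both have an infinite expectation. -/
def ExpectationDefined {Ω : Type*} [MeasurableSpace Ω] (f : Ω → ℝ) (P : Measure Ω) : Prop :=
  AEMeasurable f P ∧
    (∫⁻ ω, ENNReal.ofReal (f ω) ∂P ≠ ⊤ ∨ ∫⁻ ω, ENNReal.ofReal (-f ω) ∂P ≠ ⊤)

/-- The expectation of `f` with values in `[-∞, ∞]`, meaningful under `ExpectationDefined f P`. -/
def expectation {Ω : Type*} [MeasurableSpace Ω] (f : Ω → ℝ) (P : Measure Ω) : EReal :=
  ((∫⁻ ω, ENNReal.ofReal (f ω) ∂P : ENNReal) : EReal) -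
    ((∫⁻ ω, ENNReal.ofReal (-f ω) ∂P : ENNReal) : EReal)

/-- The expectation above is the Bochner integral for integrable functions. -/
theorem expectation_eq_integral {Ω : Type*} [MeasurableSpace Ω] {f : Ω → ℝ} {P : Measure Ω}
    (hf : Integrable f P) : expectation f P = ((∫ ω, f ω ∂P : ℝ) : EReal) := by
  have h₁ : ∫⁻ ω, ENNReal.ofReal (f ω) ∂P ≠ ⊤ := hf.lintegral_lt_top.ne
  have h₂ : ∫⁻ ω, ENNReal.ofReal (-f ω) ∂P ≠ ⊤ := hf.neg.lintegral_lt_top.ne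
  rw [expectation, integral_eq_lintegral_pos_part_sub_lintegral_neg_part hf, EReal.coe_sub,
    EReal.coe_ennreal_toReal h₁, EReal.coe_ennreal_toReal h₂]

/-- `X` is dominated by `Y` in the convex order: `E[φ(X)] ≤ E[φ(Y)]` for every convex function
`φ : ℝ → ℝ` such that both expectations are well-defined. -/
def ConvexOrderLE {Ω Ω' : Type*} [MeasurableSpace Ω] [MeasurableSpace Ω']
    (X : Ω → ℝ) (P : Measure Ω) (Y : Ω' → ℝ) (P' : Measure Ω') : Prop :=
  ∀ φ : ℝ → ℝ, ConvexOn ℝ Set.univ φ →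
    ExpectationDefined (fun ω => φ (X ω)) P → ExpectationDefined (fun ω => φ (Y ω)) P' →
    expectation (fun ω => φ (X ω)) P ≤ expectation (fun ω => φ (Y ω)) P'

end ConvexOrder

end IsingPoisson

end

noncomputable section

namespace IsingPoisson

open scoped ENNReal

-- The two fields are compared on all directionally convex functionals with values in `ℝ≥0∞`, by
-- pruning the tree leaf by leaf. The means and the correlations force the transitions of the Ising
-- model (`FactorizesOn.transition_eq`): a child is Bernoulli of mean `q(1-α)` if its parent is `0`
-- and of mean `q(1-α)+α` if its parent is `1`. These are also the conditional means `αn + q(1-α)`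
-- of a Poisson child whose parent is `n = 0` or `n = 1`. Among laws on `ℕ` of a given mean at most
-- `1`, the Bernoulli law is the smallest in the convex order. So, given the rest, replacing an
-- Ising leaf by a Poisson leaf increases the mean (`two_point_le_offspringMean_zero`,
-- `two_point_le_offspringMean_one`).
--
-- The leaf, now averaged out by `offspringMean`, leaves a functional of the smaller tree that is
-- again directionally convex (`DirectionallyConvex.offspringMean`), and the induction hypothesis
-- applies to it. The Ising side stays in the class of laws that factorise along the tree
-- (`FactorizesOn.marginal`). This gives `lintegral_ising_le_mpmrf`.
--
-- For a convex `φ`, subtracting an affine function makes it nonnegative on `[0, ∞)`. Its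
-- composition with the sum of the coordinates is then directionally convex, and the affine part is
-- restored at the end because both sums have the same mean.

/-! ### Directional convexity -/

/-- Directional convexity of a function on `ℕ^V`. -/
def DirectionallyConvex {V : Type*} (f : (V → ℕ) → ℝ≥0∞) : Prop :=
  ∀ x a b, f (x + a) + f (x + b) ≤ f (x + a + b) + f x

/-! ### Binomial thinning as an operator on functions -/

/-- The expectation of `h` under the binomial law with `n` trials, of success probability `a` and
failure probability `b`. -/
def binomialMean (b a : ℝ≥0∞) : ℕ → (ℕ → ℝ≥0∞) → ℝ≥0∞
  | 0, h => h 0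
  | n + 1, h => b * binomialMean b a n h + a * binomialMean b a n (fun i => h (i + 1))

section Binomial

variable {b a : ℝ≥0∞}

lemma binomialMean_mono (n : ℕ) {h g : ℕ → ℝ≥0∞} (hg : ∀ i, h i ≤ g i) :
    binomialMean b a n h ≤ binomialMean b a n g := by
  induction n generalizing h g with
  | zero => exact hg 0
  | succ n ih =>
    simp only [binomialMean]
    gcongr
    · exact ih hg
    · exact ih fun i => hg (i + 1)

lemma binomialMean_add (n : ℕ) (h g : ℕ → ℝ≥0∞) :
    binomialMean b a n (fun i => h i + g i) = binomialMean b a n h + binomialMean b a n g := by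
  induction n generalizing h g with
  | zero => rfl
  | succ n ih => simp only [binomialMean, ih]; ring

lemma binomialMean_const_mul (n : ℕ) (c : ℝ≥0∞) (h : ℕ → ℝ≥0∞) :
    binomialMean b a n (fun i => c * h i) = c * binomialMean b a n h := by
  induction n generalizing h with
  | zero => rfl
  | succ n ih => simp only [binomialMean, ih]; ring

lemma binomialMean_const (hab : b + a = 1) (n : ℕ) (c : ℝ≥0∞) :
    binomialMean b a n (fun _ => c) = c := by
  induction n with
  | zero => rfl
  | succ n ih => simp only [binomialMean, ih]; rw [← add_mul, hab, one_mul]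

lemma binomialMean_natCast (hab : b + a = 1) (n : ℕ) :
    binomialMean b a n (fun i => (i : ℝ≥0∞)) = n * a := by
  induction n with
  | zero => simp [binomialMean]
  | succ n ih =>
    simp only [binomialMean, Nat.cast_add, Nat.cast_one, binomialMean_add, ih,
      binomialMean_const hab]
    rw [mul_add, ← add_assoc, ← add_mul, hab]
    ring

/-- The convolution of binomial laws: thinning a sum amounts to thinning the summands independently.
-/
lemma binomialMean_add_index (m n : ℕ) (h : ℕ → ℝ≥0∞) :
    binomialMean b a (m + n) h =
      binomialMean b a m (fun i => binomialMean b a n (fun j => h (i + j))) := by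
  induction n generalizing h with
  | zero => rfl
  | succ n ih =>
    rw [← add_assoc, binomialMean, ih, ih]
    simp only [binomialMean, binomialMean_add, binomialMean_const_mul, add_assoc]

end Binomial

/-! ### Adding an offspring coordinate -/

/-- The expectation of `f` after adding a coordinate `c` which is the thinning of the coordinate `p`
plus an independent Poisson variable. -/
def offspringMean {V : Type*} [DecidableEq V] (b a : ℝ≥0∞) (lam : NNReal) (p c : V)
    (f : (V → ℕ) → ℝ≥0∞) (x : V → ℕ) : ℝ≥0∞ :=
  ∫⁻ l, binomialMean b a (x p) (fun i => f (x + Pi.single c (i + l))) ∂poissonMeasure lam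

/-- All four terms are coupled: the parent coordinates of `x`, `u`, `v` are thinned separately to
`i`, `j`, `k`, and the same `l` is added everywhere. The inequality then holds pointwise, with
`c`-coordinates increased by `i + l`, `j` and `k` respectively. -/
lemma DirectionallyConvex.offspringMean {V : Type*} [DecidableEq V] {b a : ℝ≥0∞}
    (hab : b + a = 1) (lam : NNReal) (p c : V) {f : (V → ℕ) → ℝ≥0∞}
    (hf : DirectionallyConvex f) : DirectionallyConvex (offspringMean b a lam p c f) := by
  intro x u v
  unfold IsingPoisson.offspringMean
  rw [← lintegral_add_left (Measurable.of_discrete), ← lintegral_add_left (Measurable.of_discrete)]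
  refine lintegral_mono fun l => ?_
  let T := fun n => binomialMean b a n
  have key (F : ℕ → ℕ → ℕ → ℝ≥0∞) (G : ℕ → ℕ → ℕ → ℝ≥0∞) (H : ∀ i j k, F i j k ≤ G i j k) :
      T (x p) (fun i => T (u p) fun j => T (v p) fun k => F i j k) ≤
      T (x p) (fun i => T (u p) fun j => T (v p) fun k => G i j k) :=
    binomialMean_mono _ fun i => binomialMean_mono _ fun j => binomialMean_mono _ fun k => H i j k
  have := key
    (fun i j k => f (x + u + Pi.single c (i + j + l)) + f (x + v + Pi.single c (i + k + l)))
    (fun i j k => f (x + u + v + Pi.single c (i + j + k + l)) + f (x + Pi.single c (i + l)))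
    (fun i j k => by
      have := hf (x + Pi.single c (i + l)) (u + Pi.single c j) (v + Pi.single c k)
      convert this using 3 <;> simp only [Pi.single_add] <;> abel)
  -- Trials that a term does not involve integrate to total mass `b + a = 1`.
  simp only [T, binomialMean_add, binomialMean_const hab] at this
  simpa only [Pi.add_apply, binomialMean_add_index, add_assoc] using this

/-! ### Two-point laws against laws on `ℕ` with the same mean -/

section TwoPoint

variable {h : ℕ → ℝ≥0∞}

/-- The line through the values at `0` and `1` lies below `h` on `ℕ`; `n * h 0` is moved across
because subtraction in `ℝ≥0∞` truncates. -/
lemma nat_mul_add_le_of_convex (hh : ∀ m n, h m + h n ≤ h (m + n) + h 0) (n : ℕ) :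
    n * h 1 + h 0 ≤ h n + n * h 0 := by
  induction n with
  | zero => simp
  | succ n ih =>
    calc ((n + 1 : ℕ) : ℝ≥0∞) * h 1 + h 0 = (n * h 1 + h 0) + h 1 := by push_cast; ring
      _ ≤ (h n + n * h 0) + h 1 := by gcongr
      _ = (h n + h 1) + n * h 0 := by ring
      _ ≤ (h (n + 1) + h 0) + n * h 0 := add_le_add_left (hh n 1) _
      _ = _ := by push_cast; ring

/-- A convex sequence has a smaller mean under the Bernoulli law than under any law on `ℕ` with the
same mean and an atom at zero. -/
lemma bernoulli_mean_le (hh : ∀ m n, h m + h n ≤ h (m + n) + h 0) (μ : Measure ℕ)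
    [IsProbabilityMeasure μ] {b a : ℝ≥0∞} (hab : b + a = 1) (hmean : ∫⁻ n, (n : ℝ≥0∞) ∂μ = a)
    (hμ : μ {0} ≠ 0) : b * h 0 + a * h 1 ≤ ∫⁻ n, h n ∂μ := by
  rcases eq_or_ne (h 0) ⊤ with h0 | h0
  -- An infinite `h 0` cannot be cancelled; the atom at zero then makes the right-hand side
  -- infinite.
  · have : μ {0} * h 0 ≤ ∫⁻ n, h n ∂μ := by
      calc μ {0} * h 0 = ∫⁻ n in {0}, h n ∂μ := by rw [lintegral_singleton, mul_comm]
        _ ≤ _ := setLIntegral_le_lintegral _ _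
    rw [h0, ENNReal.mul_top hμ] at this
    exact le_top.trans this
  · have ha : a ≠ ⊤ := ne_top_of_le_ne_top ENNReal.one_ne_top (hab ▸ le_add_self)
    have key : ∫⁻ n : ℕ, (n * h 1 + h 0) ∂μ ≤ ∫⁻ n : ℕ, (h n + n * h 0) ∂μ :=
      lintegral_mono fun n => nat_mul_add_le_of_convex hh n
    rw [lintegral_add_left Measurable.of_discrete, lintegral_add_left Measurable.of_discrete,
      lintegral_mul_const _ Measurable.of_discrete, lintegral_mul_const _ Measurable.of_discrete,
      hmean, lintegral_const, measure_univ, mul_one] at key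
    refine (ENNReal.add_le_add_iff_right (ENNReal.mul_ne_top ha h0)).1 (le_trans (le_of_eq ?_) key)
    calc b * h 0 + a * h 1 + a * h 0 = a * h 1 + (b + a) * h 0 := by ring
      _ = _ := by rw [hab, one_mul]

end TwoPoint

lemma poissonMeasure_zero_ne_zero (lam : NNReal) : poissonMeasure lam {0} ≠ 0 := by
  rw [poissonMeasure_singleton]
  simp [Real.exp_pos]

lemma lintegral_natCast_poissonMeasure (lam : NNReal) :
    ∫⁻ n, (n : ℝ≥0∞) ∂poissonMeasure lam = lam := by
  rw [lintegral_countable', tsum_eq_zero_add' ENNReal.summable]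
  have : ∀ n : ℕ, ((n + 1 : ℕ) : ℝ≥0∞) * poissonMeasure lam {n + 1} =
      lam * poissonMeasure lam {n} := by
    intro n
    rw [poissonMeasure_singleton, poissonMeasure_singleton, ← ENNReal.ofReal_coe_nnreal,
      ← ENNReal.ofReal_natCast, ← ENNReal.ofReal_mul (by positivity),
      ← ENNReal.ofReal_mul (by positivity), Nat.factorial_succ]
    congr 1
    push_cast
    field_simp
    exact pow_succ' _ _
  simp only [this, ENNReal.tsum_mul_left]
  have h1 : ∑' n, poissonMeasure lam {n} = 1 := by
    have := lintegral_countable' (μ := poissonMeasure lam) (fun _ => (1 : ℝ≥0∞))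
    simpa using this.symm
  simp [h1]

lemma bernoulli_mean_le_poisson {h : ℕ → ℝ≥0∞} (hh : ∀ m n, h m + h n ≤ h (m + n) + h 0)
    {b : ℝ≥0∞} {lam : NNReal} (hab : b + lam = 1) :
    b * h 0 + lam * h 1 ≤ ∫⁻ n, h n ∂poissonMeasure lam :=
  bernoulli_mean_le hh _ hab (lintegral_natCast_poissonMeasure lam) (poissonMeasure_zero_ne_zero _)

lemma DirectionallyConvex.single {V : Type*} [DecidableEq V] {f : (V → ℕ) → ℝ≥0∞}
    (hf : DirectionallyConvex f) (c : V) (x : V → ℕ) (m n : ℕ) :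
    f (x + Pi.single c m) + f (x + Pi.single c n) ≤
      f (x + Pi.single c (m + n)) + f (x + Pi.single c 0) := by
  have := hf x (Pi.single c m) (Pi.single c n)
  rw [add_assoc, ← Pi.single_add] at this
  simpa using this

/-- For a parent in state `0`, the offspring of the Ising model is dominated by that of the Poisson
model. -/
lemma two_point_le_offspringMean_zero {V : Type*} [DecidableEq V] {b a b' : ℝ≥0∞} {lam : NNReal}
    (hlam : b' + lam = 1) {p c : V} {f : (V → ℕ) → ℝ≥0∞} (hf : DirectionallyConvex f) {x : V → ℕ}
    (hx : x p = 0) : b' * f x + lam * f (x + Pi.single c 1) ≤ offspringMean b a lam p c f x := by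
  have := bernoulli_mean_le_poisson (h := fun n => f (x + Pi.single c n))
    (fun m n => hf.single c x m n) hlam
  simpa [offspringMean, hx, binomialMean] using this

/-- For a parent in state `1`, the offspring of the Ising model is dominated by that of the Poisson
model. -/
lemma two_point_le_offspringMean_one {V : Type*} [DecidableEq V] {b a b' : ℝ≥0∞} {lam : NNReal}
    (hab : b + a = 1) (hlam : b' + lam + a = 1) {p c : V} {f : (V → ℕ) → ℝ≥0∞}
    (hf : DirectionallyConvex f) {x : V → ℕ} (hx : x p = 1) :
    b' * f x + (lam + a) * f (x + Pi.single c 1) ≤ offspringMean b a lam p c f x := by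
  have ha : a ≠ ⊤ := ne_top_of_le_ne_top ENNReal.one_ne_top (hab ▸ le_add_self)
  have hb : b = b' + lam :=
    (ENNReal.add_left_inj ha).1 (hab.trans hlam.symm)
  have hbl : (b' + a) + lam = 1 := by rw [← hlam]; ring
  set h : ℕ → ℝ≥0∞ := fun n => f (x + Pi.single c n) with hh
  have hf0 : f x = h 0 := by simp [hh]
  have hc : ∀ m n, h m + h n ≤ h (m + n) + h 0 := fun m n => hf.single c x m n
  have hc1 : ∀ m n, h (m + 1) + h (n + 1) ≤ h (m + n + 1) + h (0 + 1) := by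
    intro m n
    have := hf.single c (x + Pi.single c 1) m n
    simp only [add_assoc, ← Pi.single_add] at this
    simpa only [hh, add_comm, add_left_comm, add_assoc] using this
  -- Given either outcome of the single thinning trial, the Poisson variable is replaced by a
  -- Bernoulli variable of the same mean `lam`, with failure probability `b' + a`.
  have k0 := bernoulli_mean_le_poisson hc hbl
  have k1 := bernoulli_mean_le_poisson (h := fun n => h (n + 1)) hc1 hbl
  have e : offspringMean b a lam p c f x =
      b * ∫⁻ n, h n ∂poissonMeasure lam + a * ∫⁻ n, h (n + 1) ∂poissonMeasure lam := by
    rw [← lintegral_const_mul _ Measurable.of_discrete, ← lintegral_const_mul _ Measurable.of_discrete,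
      ← lintegral_add_left Measurable.of_discrete]
    simp [offspringMean, hx, binomialMean, hh, add_comm]
  rw [e, hf0]
  -- It remains to compare a Bernoulli law of mean `lam + a` with the sum of independent Bernoulli
  -- variables of means `a` and `lam`. Factors `b' + lam + a = 1` make both sides quadratic. They
  -- differ by moving mass `2 * a * lam` from `1` equally to `0` and `2`.
  calc b' * h 0 + (lam + a) * h 1
      = (b' + lam + a) * (b' * h 0) + ((b' + lam + a) * lam + (b' + lam + a) * a) * h 1 := by
        simp [hlam, add_mul]
    _ = (b' * (b' + lam + a)) * h 0 + (b * lam + a * (b' + a)) * h 1 + a * lam * (h 1 + h 1) := by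
        rw [hb]; ring
    _ ≤ (b' * (b' + lam + a)) * h 0 + (b * lam + a * (b' + a)) * h 1
          + a * lam * (h 2 + h 0) := by
        refine add_le_add_right (mul_le_mul_right ?_ _) _
        exact hc 1 1
    _ = b * ((b' + a) * h 0 + lam * h 1) + a * ((b' + a) * h (0 + 1) + lam * h (1 + 1)) := by
        rw [hb]; ring
    _ ≤ _ := by gcongr

/-! ### Rooted trees -/

section Tree

variable {V : Type*} {G : SimpleGraph V}

/-- In a tree the path from `r` to `v` is a geodesic, and `w` is a vertex on it other than its end.
-/
lemma IsParent.dist_lt (hG : G.IsTree) {r w v : V} (h : IsParent G r w v) :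
    G.dist r w < G.dist r v := by
  classical
  obtain ⟨hadj, p, hp, hw⟩ := h
  obtain ⟨p', hp'⟩ := hG.connected.exists_walk_length_eq_dist r v
  have hpp : p = p' := (hG.existsUnique_path r v).unique hp (p'.isPath_of_length_eq_dist hp')
  calc G.dist r w ≤ (p.takeUntil w hw).length := SimpleGraph.dist_le _
    _ < p.length := p.length_takeUntil_lt_length hw hadj.ne
    _ = G.dist r v := by rw [hpp, hp']

lemma isParent_or_isParent (hG : G.IsTree) (r : V) {u v : V} (h : G.Adj u v) :
    IsParent G r u v ∨ IsParent G r v u := by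
  obtain ⟨p, hp, -⟩ := hG.existsUnique_path r u
  by_cases hv : v ∈ p.support
  · exact Or.inr ⟨h.symm, p, hp, hv⟩
  · exact Or.inl ⟨h, p.concat h, hp.concat hv h, by simp⟩

/-- The map to the parent in a rooted tree, which fixes the root. -/
structure IsParentMap (G : SimpleGraph V) (r : V) (pa : V → V) : Prop where
  root : pa r = r
  isParent : ∀ v, v ≠ r → IsParent G r (pa v) v

lemma exists_isParentMap (hG : G.IsTree) (r : V) : ∃ pa, IsParentMap G r pa := by
  classical
  refine ⟨fun v => if h : v = r then r else (existsUnique_isParent hG h).choose, by simp, ?_⟩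
  intro v hv
  simpa [hv] using (existsUnique_isParent hG hv).choose_spec.1

namespace IsParentMap

variable {r : V} {pa : V → V}

/-- Induction over the finite sets of vertices that contain the root and are closed under taking
parents, adding one leaf at a time. -/
lemma induction [Fintype V] [DecidableEq V] (h : IsParentMap G r pa) (hG : G.IsTree)
    {C : Finset V → Prop} (base : C {r})
    (step : ∀ S c, r ∈ S → (∀ v ∈ S, pa v ∈ S) → c ∉ S → pa c ∈ S → C S → C (insert c S)) :
    C Finset.univ := by
  have key : ∀ n (S : Finset V), Fintype.card V - S.card = n → r ∈ S → (∀ v ∈ S, pa v ∈ S) →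
      C S → C Finset.univ := by
    intro n
    induction n with
    | zero =>
      intro S hn _ _ hS
      have : S = Finset.univ := by
        rw [← Finset.card_eq_iff_eq_univ]
        exact le_antisymm (Finset.card_le_univ S) (by omega)
      exact this ▸ hS
    | succ n ih =>
      intro S hn hr hcl hS
      have hne : (Finset.univ \ S).Nonempty := by
        rw [← Finset.card_pos, Finset.card_sdiff_of_subset (Finset.subset_univ S),
          Finset.card_univ]
        omega
      -- A missing vertex nearest to the root has its parent, which is strictly nearer, in `S`.
      obtain ⟨c, hc, hmin⟩ := Finset.exists_min_image _ (G.dist r) hne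
      have hcS : c ∉ S := (Finset.mem_sdiff.1 hc).2
      have hcr : c ≠ r := fun e => hcS (e ▸ hr)
      have hpc : pa c ∈ S := by
        by_contra hp
        exact (hmin _ (Finset.mem_sdiff.2 ⟨Finset.mem_univ _, hp⟩)).not_gt
          ((h.isParent c hcr).dist_lt hG)
      refine ih (insert c S) ?_ (Finset.mem_insert_of_mem hr) ?_ (step S c hr hcl hcS hpc hS)
      · rw [Finset.card_insert_of_notMem hcS]; omega
      · intro v hv
        rcases Finset.mem_insert.1 hv with rfl | hv
        · exact Finset.mem_insert_of_mem hpc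
        · exact Finset.mem_insert_of_mem (hcl v hv)
  refine key _ {r} rfl (Finset.mem_singleton_self r) ?_ base
  intro v hv
  rw [Finset.mem_singleton.1 hv, h.root]
  exact Finset.mem_singleton_self r

lemma eq_of_isParent (h : IsParentMap G r pa) (hG : G.IsTree) {w v : V} (hw : IsParent G r w v) :
    w = pa v := by
  have hv : v ≠ r := by rintro rfl; exact not_isParent_root _ _ hw
  exact (existsUnique_isParent hG hv).unique hw (h.isParent v hv)

/-- Each edge is counted at its child endpoint. Two distinct children cannot yield the same edge:
each would be the parent of the other, hence strictly nearer to the root. -/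
lemma sum_edgeFinset [Fintype V] [DecidableEq V] [Fintype G.edgeSet] (h : IsParentMap G r pa)
    (hG : G.IsTree) (g : Sym2 V → ℝ) :
    ∑ e ∈ G.edgeFinset, g e = ∑ v ∈ Finset.univ.erase r, g s(pa v, v) := by
  symm
  refine Finset.sum_bij (fun v _ => s(pa v, v)) ?_ ?_ ?_ (fun _ _ => rfl)
  · intro v hv
    simpa using (h.isParent v (Finset.ne_of_mem_erase hv)).1
  · intro v hv w hw e
    rcases Sym2.eq_iff.1 e with ⟨-, e⟩ | ⟨e₁, e₂⟩
    · exact e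
    · have h₁ := (h.isParent v (Finset.ne_of_mem_erase hv)).dist_lt hG
      have h₂ := (h.isParent w (Finset.ne_of_mem_erase hw)).dist_lt hG
      rw [e₁] at h₁
      rw [← e₂] at h₂
      exact absurd h₁ h₂.asymm
  · intro e he
    induction e with
    | _ u v =>
      have hadj : G.Adj u v := by simpa using he
      have aux : ∀ {u v}, IsParent G r u v → ∃ a, ∃ (_ : a ∈ Finset.univ.erase r),
          s(pa a, a) = s(u, v) := by
        intro u v huv
        have hv : v ≠ r := by rintro rfl; exact not_isParent_root _ _ huv
        exact ⟨v, by simp [hv], by rw [h.eq_of_isParent hG huv]⟩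
      rcases isParent_or_isParent hG r hadj with huv | hvu
      · exact aux huv
      · rw [Sym2.eq_swap]; exact aux hvu

end IsParentMap

end Tree

/-! ### Restriction of configurations -/

section Restriction

variable {V : Type*} [DecidableEq V]

/-- The configuration that agrees with `x` on `S` and vanishes elsewhere. -/
def restrictTo (S : Finset V) (x : V → ℕ) : V → ℕ := fun v => if v ∈ S then x v else 0

lemma restrictTo_of_mem {S : Finset V} {v : V} (hv : v ∈ S) (x : V → ℕ) :
    restrictTo S x v = x v := if_pos hv

lemma restrictTo_insert {S : Finset V} {c : V} (hc : c ∉ S) (x : V → ℕ) :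
    restrictTo (insert c S) x = restrictTo S x + Pi.single c (x c) := by
  ext v
  by_cases hv : v = c
  · subst hv; simp [restrictTo, hc]
  · simp [restrictTo, hv]

lemma restrictTo_univ [Fintype V] (x : V → ℕ) : restrictTo Finset.univ x = x := by
  ext v; simp [restrictTo]

lemma restrictTo_singleton (r : V) (x : V → ℕ) : restrictTo {r} x = Pi.single r (x r) := by
  ext v
  by_cases hv : v = r
  · subst hv; simp [restrictTo]
  · simp [restrictTo, hv]

lemma measurable_restrictTo {Ω : Type*} {m : MeasurableSpace Ω} {S : Finset V}
    {X : V → Ω → ℕ} (hX : ∀ v ∈ S, Measurable (X v)) :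
    Measurable fun ω => restrictTo S fun v => X v ω := by
  refine measurable_pi_lambda _ fun v => ?_
  by_cases hv : v ∈ S
  · simpa [restrictTo, hv] using hX v hv
  · simp [restrictTo, hv]

end Restriction

/-! ### Independence -/

section Independence

variable {Ω : Type*}

/-- The σ-algebra generated by the variables with index in `A`. -/
abbrev generatedBy {κ : Type*} (F : κ → Ω → ℕ) (A : Set κ) : MeasurableSpace Ω :=
  ⨆ k ∈ A, MeasurableSpace.comap (F k) ⊤

lemma measurable_generatedBy {κ : Type*} {F : κ → Ω → ℕ} {A : Set κ} {k : κ} (hk : k ∈ A) :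
    Measurable[generatedBy F A] (F k) :=
  measurable_iff_comap_le.2 (le_iSup₂_of_le k hk le_rfl)

lemma measurable_pi_prodMk {m : MeasurableSpace Ω} {I : ℕ → Ω → ℕ} {X : Ω → ℕ}
    (hI : ∀ i, Measurable (I i)) (hX : Measurable X) :
    Measurable fun ω => ((fun i => I i ω), X ω) :=
  (measurable_pi_lambda _ hI).prodMk hX

lemma measurable_thinning {m : MeasurableSpace Ω} {I : ℕ → Ω → ℕ} {X : Ω → ℕ}
    (hI : ∀ i, Measurable (I i)) (hX : Measurable X) : Measurable (thinning I X) := by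
  have : Measurable fun p : ℕ × Ω => ∑ i ∈ Finset.range p.1, I i p.2 :=
    by
    refine measurable_from_prod_countable_right fun n => ?_
    exact Finset.measurable_sum (Finset.range n) fun i _ => hI i
  exact this.comp (hX.prodMk measurable_id)

variable [MeasurableSpace Ω] {P : Measure Ω}

lemma IndepFun.lintegral_pair [IsProbabilityMeasure P] {β γ : Type*} [MeasurableSpace β]
    [MeasurableSpace γ]
    {X : Ω → β} {Y : Ω → γ} (hXY : IndepFun X Y P) (hX : Measurable X) (hY : Measurable Y)
    {H : β → γ → ℝ≥0∞} (hH : Measurable (Function.uncurry H)) :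
    ∫⁻ ω, H (X ω) (Y ω) ∂P = ∫⁻ ω, ∫⁻ ω', H (X ω) (Y ω') ∂P ∂P := by
  have : IsProbabilityMeasure (P.map Y) := Measure.isProbabilityMeasure_map hY.aemeasurable
  have h1 : ∫⁻ ω, H (X ω) (Y ω) ∂P = ∫⁻ z, Function.uncurry H z ∂P.map (fun ω => (X ω, Y ω)) := by
    rw [lintegral_map hH (hX.prodMk hY)]; rfl
  rw [h1, hXY.map_prod_eq_prod_map_map hX.aemeasurable hY.aemeasurable, lintegral_prod _
    hH.aemeasurable, lintegral_map hH.lintegral_prod_right' hX]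
  refine lintegral_congr fun ω => ?_
  exact lintegral_map (f := fun y => Function.uncurry H (X ω, y))
    (hH.comp measurable_prodMk_left) hY

lemma generatedBy_le {κ : Type*} {F : κ → Ω → ℕ} (hF : ∀ k, Measurable (F k)) (A : Set κ) :
    generatedBy F A ≤ ‹MeasurableSpace Ω› :=
  iSup₂_le fun k _ => (hF k).comap_le

lemma indepFun_of_generatedBy {κ : Type*} {F : κ → Ω → ℕ} (hF : ∀ k, Measurable (F k))
    (hind : iIndepFun F P) {A B : Set κ} (hAB : Disjoint A B) {β γ : Type*} [MeasurableSpace β]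
    [MeasurableSpace γ] {X : Ω → β} {Y : Ω → γ} (hX : Measurable[generatedBy F A] X)
    (hY : Measurable[generatedBy F B] Y) : IndepFun X Y P := by
  rw [IndepFun_iff_Indep]
  have := indep_iSup_of_disjoint (fun k => (hF k).comap_le) ((iIndepFun_iff_iIndep _ _ _).1 hind) hAB
  exact indep_of_indep_of_le_left (indep_of_indep_of_le_right this hY.comap_le) hX.comap_le

lemma lintegral_bernoulli [IsProbabilityMeasure P] {X : Ω → ℕ} (hX : Measurable X) {a : ℝ}
    (h1 : P.real {ω | X ω = 1} = a) (h0 : P.real {ω | X ω = 0} = 1 - a) (g : ℕ → ℝ≥0∞) :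
    ∫⁻ ω, g (X ω) ∂P = ENNReal.ofReal (1 - a) * g 0 + ENNReal.ofReal a * g 1 := by
  have hprob : IsProbabilityMeasure (P.map X) := Measure.isProbabilityMeasure_map hX.aemeasurable
  have e (n : ℕ) : P.map X {n} = ENNReal.ofReal (P.real {ω | X ω = n}) := by
    rw [Measure.map_apply hX (measurableSet_singleton n), ofReal_measureReal]; rfl
  rw [← lintegral_map (f := g) Measurable.of_discrete hX, lintegral_countable',
    tsum_eq_sum (s := {0, 1})]
  · rw [Finset.sum_pair zero_ne_one, e, e, h0, h1, mul_comm, mul_comm (g 1)]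
  · intro n hn
    have h01 : P.map X {0, 1} = 1 := by
      rw [← Set.singleton_union, measure_union (by simp) (measurableSet_singleton 1), e, e, h0, h1,
        ← ENNReal.ofReal_add (h0 ▸ measureReal_nonneg) (h1 ▸ measureReal_nonneg)]
      simp
    have h2 : P.map X ({0, 1}ᶜ) = 0 := (prob_compl_eq_zero_iff (by measurability)).2 h01
    rw [measure_mono_null _ h2, mul_zero]
    simpa using hn

end Independence

/-! ### The Poisson field along a rooted tree -/

namespace IsMPMRFRepr

variable {V : Type*} {G : SimpleGraph V} {r : V} {lam : ℝ} {α : Sym2 V → ℝ}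
  {Ω : Type*} [MeasurableSpace Ω] {P : Measure Ω} {N L : V → Ω → ℕ} {I : V → ℕ → Ω → ℕ}

/-- The family of all variables that drive the stochastic representation. -/
def drivers (L : V → Ω → ℕ) (I : V → ℕ → Ω → ℕ) (k : V ⊕ V × ℕ) : Ω → ℕ :=
  Sum.elim L (fun p : V × ℕ => I p.1 p.2) k

/-- The indices of the driving variables attached to a vertex of `S`. -/
def driverIndices (S : Set V) : Set (V ⊕ V × ℕ) := {k | Sum.elim id Prod.fst k ∈ S}

lemma measurable_drivers (h : IsMPMRFRepr G r lam α P N L I) (k : V ⊕ V × ℕ) :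
    Measurable (drivers L I k) := by
  rcases k with v | ⟨v, i⟩
  · exact h.measurable_L v
  · exact h.measurable_I v i

omit [MeasurableSpace Ω] in
lemma measurable_driver_left {S : Set V} {v : V} (hv : v ∈ S) :
    Measurable[generatedBy (drivers L I) (driverIndices S)] (L v) :=
  measurable_generatedBy (F := drivers L I) (k := Sum.inl v) hv

omit [MeasurableSpace Ω] in
lemma measurable_driver_right {S : Set V} {v : V} (hv : v ∈ S) (i : ℕ) :
    Measurable[generatedBy (drivers L I) (driverIndices S)] (I v i) :=
  measurable_generatedBy (F := drivers L I) (k := Sum.inr (v, i)) hv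

/-- Unfolding the recursion towards the root only meets vertices of `S`, so the field on `S` uses
only drivers attached to `S`. This is the source of its independence from the drivers of a new leaf.
-/
lemma measurable_generatedBy_of_mem (h : IsMPMRFRepr G r lam α P N L I) (hG : G.IsTree)
    {pa : V → V} (hpa : IsParentMap G r pa) {S : Finset V} (hS : ∀ v ∈ S, pa v ∈ S) {v : V}
    (hv : v ∈ S) : Measurable[generatedBy (drivers L I) (driverIndices (S : Set V))] (N v) := by
  induction hn : G.dist r v using Nat.strong_induction_on generalizing v with
  | _ n ih =>
    have hLv : Measurable[generatedBy (drivers L I) (driverIndices (S : Set V))] (L v) :=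
      measurable_driver_left (Finset.mem_coe.2 hv)
    by_cases hvr : v = r
    · subst hvr
      rwa [show N v = L v from funext h.root]
    · have hp := hpa.isParent v hvr
      have hNp := ih _ (hn ▸ hp.dist_lt hG) (hS v hv) rfl
      rw [show N v = fun ω => thinning (I v) (N (pa v)) ω + L v ω from
        funext (h.step _ _ hp)]
      exact (measurable_thinning (fun i => measurable_driver_right (Finset.mem_coe.2 hv) i)
        hNp).add hLv

/-- Conditioning on the last trial, which is independent of the other ones and of `L c`, reproduces
the recursion that defines `binomialMean`. -/
lemma lintegral_sum_add [IsProbabilityMeasure P] (h : IsMPMRFRepr G r lam α P N L I) {w c : V}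
    (hc : IsParent G r w c) (n : ℕ) (g : ℕ → ℝ≥0∞) :
    ∫⁻ ω, g (∑ i ∈ Finset.range n, I c i ω + L c ω) ∂P =
      ∫⁻ l, binomialMean (ENNReal.ofReal (1 - α s(w, c))) (ENNReal.ofReal (α s(w, c))) n
        (fun i => g (i + l)) ∂poissonMeasure (lam * (1 - α s(w, c))).toNNReal := by
  induction n generalizing g with
  | zero =>
    simp only [Finset.range_zero, Finset.sum_empty, zero_add, binomialMean]
    rw [← h.law_L w c hc, lintegral_map Measurable.of_discrete (h.measurable_L c)]
  | succ n ih =>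
    have hind : IndepFun (I c n) (fun ω => ∑ i ∈ Finset.range n, I c i ω + L c ω) P := by
      refine indepFun_of_generatedBy h.measurable_drivers h.indep (A := {Sum.inr (c, n)})
        (B := {Sum.inr (c, n)}ᶜ) disjoint_compl_right
        (measurable_generatedBy (F := drivers L I) (k := Sum.inr (c, n)) rfl) ?_
      refine Measurable.add (Finset.measurable_sum _ fun i hi => ?_) ?_
      · refine measurable_generatedBy (F := drivers L I) (k := Sum.inr (c, i)) ?_
        simpa using (Finset.mem_range.1 hi).ne
      · exact measurable_generatedBy (F := drivers L I) (k := Sum.inl c) (by simp)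
    have hm : Measurable fun ω => ∑ i ∈ Finset.range n, I c i ω + L c ω :=
      (Finset.measurable_sum _ fun i _ => h.measurable_I c i).add (h.measurable_L c)
    have key := IndepFun.lintegral_pair hind (h.measurable_I c n) hm
      (H := fun i s => g (s + i)) Measurable.of_discrete
    have hI := h.law_I w c hc n
    have e : ∀ ω, g (∑ i ∈ Finset.range (n + 1), I c i ω + L c ω) =
        g ((∑ i ∈ Finset.range n, I c i ω + L c ω) + I c n ω) := by
      intro ω; rw [Finset.sum_range_succ]; congr 1; ring
    simp only [e, key]
    rw [lintegral_bernoulli (h.measurable_I c n) hI.1 hI.2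
      (fun i => ∫⁻ ω', g ((∑ i ∈ Finset.range n, I c i ω' + L c ω') + i) ∂P),
      ih (fun s => g (s + 0)), ih (fun s => g (s + 1))]
    rw [← lintegral_const_mul _ Measurable.of_discrete, ← lintegral_const_mul _ Measurable.of_discrete,
      ← lintegral_add_left Measurable.of_discrete]
    simp only [binomialMean, add_zero, add_right_comm]

omit [MeasurableSpace Ω] in
lemma disjoint_driverIndices {S T : Set V} (h : Disjoint S T) :
    Disjoint (driverIndices S) (driverIndices T) :=
  h.preimage (Sum.elim id Prod.fst)

/-- The field on a closed set of vertices is independent of the variables that drive another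
vertex. -/
lemma indepFun_restrictTo [DecidableEq V] (h : IsMPMRFRepr G r lam α P N L I) (hG : G.IsTree)
    {pa : V → V} (hpa : IsParentMap G r pa) {S : Finset V} (hS : ∀ v ∈ S, pa v ∈ S)
    {c : V} (hc : c ∉ S) :
    IndepFun (fun ω => restrictTo S fun v => N v ω) (fun ω => ((fun i => I c i ω), L c ω)) P := by
  have hX : Measurable[generatedBy (drivers L I) (driverIndices (S : Set V))]
      fun ω => restrictTo S fun v => N v ω := by
    refine measurable_restrictTo fun v hv => ?_
    exact h.measurable_generatedBy_of_mem hG hpa hS hv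
  have hY : Measurable[generatedBy (drivers L I) (driverIndices {c})]
      fun ω => ((fun i => I c i ω), L c ω) := by
    refine measurable_pi_prodMk (fun i => ?_) ?_
    · exact measurable_driver_right (Set.mem_singleton c) i
    · exact measurable_driver_left (Set.mem_singleton c)
  exact indepFun_of_generatedBy h.measurable_drivers h.indep
    (disjoint_driverIndices (by simpa using hc)) hX hY

lemma measurable_of_closed (h : IsMPMRFRepr G r lam α P N L I) (hG : G.IsTree)
    {pa : V → V} (hpa : IsParentMap G r pa) {S : Finset V} (hS : ∀ v ∈ S, pa v ∈ S) {v : V}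
    (hv : v ∈ S) : Measurable (N v) :=
  (h.measurable_generatedBy_of_mem hG hpa hS hv).mono (generatedBy_le h.measurable_drivers _) le_rfl

lemma measurable_add_single_sum [Finite V] [DecidableEq V] (p c : V) (f : (V → ℕ) → ℝ≥0∞) :
    Measurable (Function.uncurry fun (x : V → ℕ) (y : (ℕ → ℕ) × ℕ) =>
      f (x + Pi.single c (∑ i ∈ Finset.range (x p), y.1 i + y.2))) := by
  refine measurable_from_prod_countable_right fun x => ?_
  have : Measurable fun y : (ℕ → ℕ) × ℕ => ∑ i ∈ Finset.range (x p), y.1 i + y.2 :=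
    (Finset.measurable_sum _ fun i _ => (measurable_pi_apply i).comp measurable_fst).add
      measurable_snd
  have hf : Measurable fun n : ℕ => f (x + Pi.single c n) := .of_discrete
  exact hf.comp this

/-- Integrating out a leaf of the Poisson field. -/
lemma lintegral_restrictTo_insert [Finite V] [DecidableEq V] [IsProbabilityMeasure P]
    (h : IsMPMRFRepr G r lam α P N L I) (hG : G.IsTree)
    {pa : V → V} (hpa : IsParentMap G r pa) {S : Finset V} (hr : r ∈ S) (hS : ∀ v ∈ S, pa v ∈ S)
    {c : V} (hc : c ∉ S) (hpc : pa c ∈ S) (f : (V → ℕ) → ℝ≥0∞) :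
    ∫⁻ ω, f (restrictTo (insert c S) fun v => N v ω) ∂P =
      ∫⁻ ω, offspringMean (ENNReal.ofReal (1 - α s(pa c, c))) (ENNReal.ofReal (α s(pa c, c)))
        (lam * (1 - α s(pa c, c))).toNNReal (pa c) c f (restrictTo S fun v => N v ω) ∂P := by
  have hp := hpa.isParent c fun e => hc (e ▸ hr)
  have key := IndepFun.lintegral_pair (h.indepFun_restrictTo hG hpa hS hc)
    (measurable_restrictTo fun v hv => h.measurable_of_closed hG hpa hS hv)
    ((measurable_pi_lambda _ fun i => h.measurable_I c i).prodMk (h.measurable_L c))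
    (measurable_add_single_sum (pa c) c f)
  have e : ∀ ω, (restrictTo (insert c S) fun v => N v ω) =
      (restrictTo S fun v => N v ω) + Pi.single c (∑ i ∈ Finset.range
        (restrictTo S (fun v => N v ω) (pa c)), I c i ω + L c ω) := by
    intro ω
    rw [restrictTo_insert hc, restrictTo_of_mem hpc, h.step _ _ hp ω, thinning]
  simp only [e]
  refine key.trans (lintegral_congr fun ω => ?_)
  exact h.lintegral_sum_add hp _ (fun n => f ((restrictTo S fun v => N v ω) + Pi.single c n))

/-- The vertices of the Poisson field have the common mean `lam`. -/
lemma lintegral_eq [Fintype V] [DecidableEq V] [IsProbabilityMeasure P]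
    (h : IsMPMRFRepr G r lam α P N L I) (hG : G.IsTree) (hlam : 0 ≤ lam)
    (hα : ∀ e ∈ G.edgeSet, α e ∈ Set.Ioo (0 : ℝ) 1) (v : V) :
    ∫⁻ ω, (N v ω : ℝ≥0∞) ∂P = ENNReal.ofReal lam := by
  obtain ⟨pa, hpa⟩ := exists_isParentMap hG r
  have hroot : ∫⁻ ω, (N r ω : ℝ≥0∞) ∂P = ENNReal.ofReal lam := by
    simp only [h.root]
    rw [← lintegral_map (f := fun n : ℕ => (n : ℝ≥0∞)) Measurable.of_discrete (h.measurable_L r),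
      h.law_L_root, lintegral_natCast_poissonMeasure]
    rfl
  refine hpa.induction hG (C := fun S => ∀ v ∈ S, ∫⁻ ω, (N v ω : ℝ≥0∞) ∂P = ENNReal.ofReal lam)
    ?_ ?_ v (Finset.mem_univ v)
  · intro v hv
    rwa [Finset.mem_singleton.1 hv]
  · intro S c hr hS hc hpc ih v hv
    rcases Finset.mem_insert.1 hv with rfl | hv
    · have hp := hpa.isParent v fun e => hc (e ▸ hr)
      obtain ⟨h0, h1⟩ := hα s(pa v, v) hp.1
      have key := h.lintegral_restrictTo_insert hG hpa hr hS hc hpc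
        (fun x => (x v : ℝ≥0∞))
      simp only [restrictTo_of_mem (Finset.mem_insert_self v S)] at key
      have hab : ENNReal.ofReal (1 - α s(pa v, v)) + ENNReal.ofReal (α s(pa v, v)) = 1 := by
        rw [← ENNReal.ofReal_add (by linarith) h0.le]; simp
      -- The conditional mean of a child is `α` times its parent plus `lam * (1 - α)`, so the mean
      -- `lam` is preserved.
      have e : ∀ x : V → ℕ, offspringMean (ENNReal.ofReal (1 - α s(pa v, v)))
          (ENNReal.ofReal (α s(pa v, v))) (lam * (1 - α s(pa v, v))).toNNReal (pa v) v
          (fun x => (x v : ℝ≥0∞)) (restrictTo S x) =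
          x (pa v) * ENNReal.ofReal (α s(pa v, v)) +
            ENNReal.ofReal (lam * (1 - α s(pa v, v))) := by
        intro x
        have h0 : restrictTo S x v = 0 := by simp [restrictTo, hc]
        simp only [offspringMean, Pi.add_apply, h0, Pi.single_eq_same, zero_add, Nat.cast_add,
          binomialMean_add, binomialMean_natCast hab, binomialMean_const hab,
          restrictTo_of_mem hpc]
        rw [lintegral_add_left Measurable.of_discrete, lintegral_natCast_poissonMeasure]
        simp [ENNReal.ofReal]
      rw [key]
      simp only [e]
      rw [lintegral_add_right _ measurable_const, lintegral_mul_const', ih _ hpc,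
        ← ENNReal.ofReal_mul hlam]
      · simp only [lintegral_const, measure_univ, mul_one]
        rw [← ENNReal.ofReal_add (by positivity) (mul_nonneg hlam (by linarith))]
        congr 1; ring
      · simp
    · exact ih v hv

end IsMPMRFRepr

/-! ### Vectors of Bernoulli variables -/

section Bernoulli

variable {Ω : Type*} [MeasurableSpace Ω] {P : Measure Ω}

lemma integral_eq_measureReal_of_le_one {X : Ω → ℕ} (hX : Measurable X) (h : ∀ᵐ ω ∂P, X ω ≤ 1) :
    ∫ ω, (X ω : ℝ) ∂P = P.real {ω | X ω = 1} := by
  have hs : MeasurableSet {ω | X ω = 1} := hX (measurableSet_singleton 1)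
  rw [← integral_indicator_one hs]
  refine integral_congr_ae ?_
  filter_upwards [h] with ω hω
  by_cases h1 : X ω = 1
  · simp [Set.indicator, h1]
  · have h0 : X ω = 0 := by omega
    simp [Set.indicator, h0]

lemma measureReal_eq_zero_of_le_one [IsProbabilityMeasure P] {X : Ω → ℕ} (hX : Measurable X)
    (h : ∀ᵐ ω ∂P, X ω ≤ 1) : P.real {ω | X ω = 0} = 1 - P.real {ω | X ω = 1} := by
  have hs : MeasurableSet {ω | X ω = 1} := hX (measurableSet_singleton 1)
  rw [← probReal_compl_eq_one_sub hs]
  refine measureReal_congr ?_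
  filter_upwards [h] with ω hω
  refine propext ?_
  change X ω = 0 ↔ ¬ X ω = 1
  omega

lemma integral_mul_eq_measureReal_of_le_one {X Y : Ω → ℕ} (hX : Measurable X) (hY : Measurable Y)
    (h : ∀ᵐ ω ∂P, X ω ≤ 1) (h' : ∀ᵐ ω ∂P, Y ω ≤ 1) :
    ∫ ω, (X ω : ℝ) * Y ω ∂P = P.real {ω | X ω = 1 ∧ Y ω = 1} := by
  have := integral_eq_measureReal_of_le_one (P := P) (hX.mul hY) (by
    filter_upwards [h, h'] with ω h1 h2
    exact Nat.mul_le_mul h1 h2)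
  simpa using this

lemma memLp_of_le_one [IsFiniteMeasure P] {X : Ω → ℕ} (hX : Measurable X)
    (h : ∀ᵐ ω ∂P, X ω ≤ 1) : MemLp (fun ω => (X ω : ℝ)) 2 P := by
  refine MemLp.of_bound (measurable_from_top.comp hX).aestronglyMeasurable 1 ?_
  filter_upwards [h] with ω hω
  simpa using hω

/-- The probability that two Bernoulli variables of the same mean are both equal to `1`. -/
lemma measureReal_both_eq_one [IsProbabilityMeasure P] {X Y : Ω → ℕ} (hX : Measurable X)
    (hY : Measurable Y) (h : ∀ᵐ ω ∂P, X ω ≤ 1) (h' : ∀ᵐ ω ∂P, Y ω ≤ 1) {q a : ℝ}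
    (hq : q ∈ Set.Ioo (0 : ℝ) 1) (hXq : ∫ ω, (X ω : ℝ) ∂P = q) (hYq : ∫ ω, (Y ω : ℝ) ∂P = q)
    (hcorr : pearsonCorr (fun ω => (X ω : ℝ)) (fun ω => (Y ω : ℝ)) P = a) :
    P.real {ω | X ω = 1 ∧ Y ω = 1} = q ^ 2 + a * (q * (1 - q)) := by
  have var {Z : Ω → ℕ} (hZ : Measurable Z) (hZ1 : ∀ᵐ ω ∂P, Z ω ≤ 1)
      (hZq : ∫ ω, (Z ω : ℝ) ∂P = q) : Var[fun ω => (Z ω : ℝ); P] = q * (1 - q) := by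
    rw [variance_eq_sub (memLp_of_le_one hZ hZ1)]
    have : ∫ ω, ((fun ω => (Z ω : ℝ)) ^ 2) ω ∂P = q := by
      rw [← hZq]
      refine integral_congr_ae ?_
      filter_upwards [hZ1] with ω hω
      rcases Nat.le_one_iff_eq_zero_or_eq_one.1 hω with e | e <;> simp [e]
    rw [this, hZq]; ring
  have hpos : 0 < q * (1 - q) := mul_pos hq.1 (by linarith [hq.2])
  rw [pearsonCorr, var hX h hXq, var hY h' hYq, Real.sqrt_mul_self hpos.le,
    div_eq_iff hpos.ne', covariance_eq_sub (memLp_of_le_one hX h) (memLp_of_le_one hY h'),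
    hXq, hYq] at hcorr
  have := integral_mul_eq_measureReal_of_le_one hX hY h h'
  simp only [Pi.mul_apply] at hcorr
  rw [← this]
  linarith

end Bernoulli

/-! ### Marginalisation of tree-factorised laws -/

section Factorization

variable {V : Type*} {Ω : Type*} [MeasurableSpace Ω] {P : Measure Ω}
  {J : V → Ω → ℕ} {pa : V → V}

/-- The law of the restriction of `J` to `S` is a product of positive factors, one for each vertex,
that depend on the states of the vertex and of its parent. -/
structure FactorizesOn (P : Measure Ω) (J : V → Ω → ℕ) (pa : V → V) (S : Finset V)
    (k : V → ℕ → ℕ → ℝ) : Prop where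
  pos : ∀ v a b, 0 < k v a b
  eq_prod : ∀ x : V → ℕ, (∀ v, x v ≤ 1) →
    P.real {ω | ∀ v ∈ S, J v ω = x v} = ∏ v ∈ S, k v (x (pa v)) (x v)

namespace FactorizesOn

/-- The conditional probability of the state `b` given the state `a` of the parent. -/
def transition (k : V → ℕ → ℕ → ℝ) (c : V) (b a : ℕ) : ℝ := k c a b / (k c a 0 + k c a 1)

variable [DecidableEq V] {S : Finset V} {k : V → ℕ → ℕ → ℝ} {c : V}

lemma transition_nonneg (h : FactorizesOn P J pa (insert c S) k) (b a : ℕ) :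
    0 ≤ transition k c b a :=
  div_nonneg (h.pos _ _ _).le (add_pos (h.pos _ _ _) (h.pos _ _ _)).le

lemma transition_zero_add_one (h : FactorizesOn P J pa (insert c S) k) (a : ℕ) :
    transition k c 0 a + transition k c 1 a = 1 := by
  rw [transition, transition, ← add_div]
  exact div_self (add_pos (h.pos _ _ _) (h.pos _ _ _)).ne'

/-- Changing the state at `c` affects only the factor of `c`: since `S` is closed under parents, `c`
is the parent of no vertex of `S`. -/
lemma measureReal_leaf (h : FactorizesOn P J pa (insert c S) k) (hS : ∀ v ∈ S, pa v ∈ S)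
    (hc : c ∉ S) (hpc : pa c ∈ S) {x : V → ℕ} (hx : ∀ v, x v ≤ 1) {b : ℕ} (hb : b ≤ 1) :
    P.real {ω | (∀ v ∈ S, J v ω = x v) ∧ J c ω = b} =
      (∏ v ∈ S, k v (x (pa v)) (x v)) * k c (x (pa c)) b := by
  have hne {v : V} (hv : v ∈ S) : v ≠ c := fun e => hc (e ▸ hv)
  have := h.eq_prod (Function.update x c b) (fun v => by
    by_cases hv : v = c
    · subst hv; simpa using hb
    · simpa [hv] using hx v)
  rw [Finset.prod_insert hc, mul_comm] at this
  convert this using 2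
  · ext ω
    simp only [Set.mem_ofPred_eq, Finset.forall_mem_insert, Function.update_self]
    rw [and_comm]
    refine and_congr_right fun _ => forall₂_congr fun v hv => ?_
    rw [Function.update_of_ne (hne hv)]
  · refine Finset.prod_congr rfl fun v hv => ?_
    rw [Function.update_of_ne (hne hv), Function.update_of_ne (hne (hS v hv))]
  · rw [Function.update_self, Function.update_of_ne (hne hpc)]

lemma measureReal_marginal [IsFiniteMeasure P] (h : FactorizesOn P J pa (insert c S) k)
    (hJ : ∀ v, Measurable (J v)) (hJ1 : ∀ᵐ ω ∂P, ∀ v, J v ω ≤ 1) (hS : ∀ v ∈ S, pa v ∈ S)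
    (hc : c ∉ S) (hpc : pa c ∈ S) {x : V → ℕ} (hx : ∀ v, x v ≤ 1) :
    P.real {ω | ∀ v ∈ S, J v ω = x v} =
      (∏ v ∈ S, k v (x (pa v)) (x v)) * (k c (x (pa c)) 0 + k c (x (pa c)) 1) := by
  rw [mul_add, ← h.measureReal_leaf hS hc hpc hx zero_le_one,
    ← h.measureReal_leaf hS hc hpc hx le_rfl, ← measureReal_union]
  · refine measureReal_congr ?_
    filter_upwards [hJ1] with ω hω
    have := Nat.le_one_iff_eq_zero_or_eq_one.1 (hω c)
    refine propext ?_
    change (∀ v ∈ S, J v ω = x v) ↔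
      ((∀ v ∈ S, J v ω = x v) ∧ J c ω = 0) ∨ ((∀ v ∈ S, J v ω = x v) ∧ J c ω = 1)
    tauto
  · rw [Set.disjoint_left]
    rintro ω ⟨-, h0⟩ ⟨-, h1⟩
    omega
  · have h1 : MeasurableSet {ω | ∀ v ∈ S, J v ω = x v} := by
      have : {ω | ∀ v ∈ S, J v ω = x v} = ⋂ v ∈ S, J v ⁻¹' {x v} := by ext; simp
      rw [this]
      exact S.measurableSet_biInter fun v _ => hJ v (measurableSet_singleton _)
    exact h1.inter (hJ c (measurableSet_singleton 1))

/-- Summing over the states of the leaf leaves a function of the state of its parent, which the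
factor of the parent absorbs. The factors need not be normalised, so the form persists. -/
lemma marginal [IsFiniteMeasure P] (h : FactorizesOn P J pa (insert c S) k)
    (hJ : ∀ v, Measurable (J v)) (hJ1 : ∀ᵐ ω ∂P, ∀ v, J v ω ≤ 1) (hS : ∀ v ∈ S, pa v ∈ S)
    (hc : c ∉ S) (hpc : pa c ∈ S) :
    FactorizesOn P J pa S
      (fun v a b => k v a b * if v = pa c then k c b 0 + k c b 1 else 1) where
  pos v a b := by
    refine mul_pos (h.pos _ _ _) ?_
    split_ifs
    · exact add_pos (h.pos _ _ _) (h.pos _ _ _)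
    · exact one_pos
  eq_prod x hx := by
    rw [h.measureReal_marginal hJ hJ1 hS hc hpc hx, Finset.prod_mul_distrib,
      Finset.prod_ite_eq' S (pa c) (fun v => k c (x v) 0 + k c (x v) 1), if_pos hpc]

lemma measureReal_leaf_eq_transition [IsFiniteMeasure P] (h : FactorizesOn P J pa (insert c S) k)
    (hJ : ∀ v, Measurable (J v)) (hJ1 : ∀ᵐ ω ∂P, ∀ v, J v ω ≤ 1) (hS : ∀ v ∈ S, pa v ∈ S)
    (hc : c ∉ S) (hpc : pa c ∈ S) {x : V → ℕ} (hx : ∀ v, x v ≤ 1) {b : ℕ} (hb : b ≤ 1) :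
    P.real {ω | (∀ v ∈ S, J v ω = x v) ∧ J c ω = b} =
      transition k c b (x (pa c)) * P.real {ω | ∀ v ∈ S, J v ω = x v} := by
  have := (add_pos (h.pos c (x (pa c)) 0) (h.pos c (x (pa c)) 1)).ne'
  rw [h.measureReal_leaf hS hc hpc hx hb, h.measureReal_marginal hJ hJ1 hS hc hpc hx, transition]
  field_simp

/-- The Markov property: given the configuration on `S`, the leaf `c` depends on its parent only. -/
lemma setLIntegral_leaf [Finite V] [IsFiniteMeasure P] (h : FactorizesOn P J pa (insert c S) k)
    (hJ : ∀ v, Measurable (J v)) (hJ1 : ∀ᵐ ω ∂P, ∀ v, J v ω ≤ 1) (hS : ∀ v ∈ S, pa v ∈ S)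
    (hc : c ∉ S) (hpc : pa c ∈ S) {b : ℕ} (hb : b ≤ 1) (F : (V → ℕ) → ℝ≥0∞) :
    ∫⁻ ω in {ω | J c ω = b}, F (restrictTo S fun v => J v ω) ∂P =
      ∫⁻ ω, ENNReal.ofReal (transition k c b (J (pa c) ω)) * F (restrictTo S fun v => J v ω) ∂P := by
  have hX : Measurable fun ω => restrictTo S fun v => J v ω :=
    measurable_restrictTo fun v _ => hJ v
  have e : ∀ ω, ENNReal.ofReal (transition k c b (J (pa c) ω)) * F (restrictTo S fun v => J v ω) =
      (fun x : V → ℕ => ENNReal.ofReal (transition k c b (x (pa c))) * F x)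
        (restrictTo S fun v => J v ω) := by
    intro ω
    simp only [restrictTo_of_mem hpc]
  simp only [e]
  rw [← lintegral_map (f := F) Measurable.of_discrete hX, lintegral_countable',
    ← lintegral_map (f := fun x : V → ℕ => ENNReal.ofReal (transition k c b (x (pa c))) * F x)
      Measurable.of_discrete hX, lintegral_countable']
  refine tsum_congr fun x => ?_
  rw [mul_comm (ENNReal.ofReal _), mul_assoc]
  congr 1
  rw [Measure.map_apply hX (measurableSet_singleton x),
    Measure.map_apply hX (measurableSet_singleton x),
    Measure.restrict_apply (hX (measurableSet_singleton x))]
  -- Any other `x` is almost surely not a value of the restricted field, so both sides vanish.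
  by_cases hx : ∀ v, x v ≤ 1 ∧ (v ∉ S → x v = 0)
  · have hset : (fun ω => restrictTo S fun v => J v ω) ⁻¹' {x} = {ω | ∀ v ∈ S, J v ω = x v} := by
      ext ω
      simp only [Set.mem_preimage, Set.mem_singleton_iff, Set.mem_ofPred_eq, funext_iff, restrictTo]
      refine ⟨fun H v hv => by simpa [hv] using H v, fun H v => ?_⟩
      by_cases hv : v ∈ S
      · simpa [hv] using H v hv
      · simp [hv, (hx v).2 hv]
    rw [hset, ← ofReal_measureReal (s := {ω | ∀ v ∈ S, J v ω = x v}),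
      ← ENNReal.ofReal_mul (h.transition_nonneg _ _),
      ← h.measureReal_leaf_eq_transition hJ hJ1 hS hc hpc (fun v => (hx v).1) hb,
      ofReal_measureReal]
    rfl
  · have hnull : P ((fun ω => restrictTo S fun v => J v ω) ⁻¹' {x}) = 0 := by
      rw [measure_eq_zero_iff_ae_notMem]
      filter_upwards [hJ1] with ω hω hxω
      refine hx fun v => ?_
      have hxω : (restrictTo S fun v => J v ω) = x := hxω
      rw [← hxω]
      by_cases hv : v ∈ S
      · simpa [restrictTo, hv] using hω v
      · simp [restrictTo, hv]
    rw [hnull, mul_zero]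
    exact measure_mono_null Set.inter_subset_left hnull

/-- Integrating out a leaf of a tree-factorised law. -/
lemma lintegral_restrictTo_insert [Finite V] [IsFiniteMeasure P]
    (h : FactorizesOn P J pa (insert c S) k)
    (hJ : ∀ v, Measurable (J v)) (hJ1 : ∀ᵐ ω ∂P, ∀ v, J v ω ≤ 1) (hS : ∀ v ∈ S, pa v ∈ S)
    (hc : c ∉ S) (hpc : pa c ∈ S) (f : (V → ℕ) → ℝ≥0∞) :
    ∫⁻ ω, f (restrictTo (insert c S) fun v => J v ω) ∂P =
      ∫⁻ ω, (ENNReal.ofReal (transition k c 0 (J (pa c) ω)) * f (restrictTo S fun v => J v ω) +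
        ENNReal.ofReal (transition k c 1 (J (pa c) ω)) *
          f ((restrictTo S fun v => J v ω) + Pi.single c 1)) ∂P := by
  have hX : Measurable fun ω => restrictTo S fun v => J v ω :=
    measurable_restrictTo fun v _ => hJ v
  have hm0 : MeasurableSet {ω | J c ω = 0} := hJ c (measurableSet_singleton 0)
  have hm1 : MeasurableSet {ω | J c ω = 1} := hJ c (measurableSet_singleton 1)
  have hmeas : Measurable fun ω =>
      ENNReal.ofReal (transition k c 0 (J (pa c) ω)) * f (restrictTo S fun v => J v ω) :=
    ((Measurable.of_discrete (f := fun a => ENNReal.ofReal (transition k c 0 a))).comp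
      (hJ (pa c))).mul ((Measurable.of_discrete (f := f)).comp hX)
  have hleaf := h.setLIntegral_leaf hJ hJ1 hS hc hpc le_rfl (fun x => f (x + Pi.single c 1))
  beta_reduce at hleaf
  rw [lintegral_add_left hmeas, ← h.setLIntegral_leaf hJ hJ1 hS hc hpc zero_le_one f,
    ← hleaf, ← lintegral_indicator hm0, ← lintegral_indicator hm1, ← lintegral_add_left]
  · refine lintegral_congr_ae ?_
    filter_upwards [hJ1] with ω hω
    rw [restrictTo_insert hc]
    rcases Nat.le_one_iff_eq_zero_or_eq_one.1 (hω c) with e | e <;> simp [Set.indicator, e]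
  · exact ((Measurable.of_discrete (f := f)).comp hX).indicator hm0

/-- The joint law of a leaf and its parent. -/
lemma measureReal_parent_leaf [Finite V] [IsFiniteMeasure P]
    (h : FactorizesOn P J pa (insert c S) k)
    (hJ : ∀ v, Measurable (J v)) (hJ1 : ∀ᵐ ω ∂P, ∀ v, J v ω ≤ 1) (hS : ∀ v ∈ S, pa v ∈ S)
    (hc : c ∉ S) (hpc : pa c ∈ S) (a : ℕ) :
    P.real {ω | J (pa c) ω = a ∧ J c ω = 1} =
      transition k c 1 a * P.real {ω | J (pa c) ω = a} := by
  have hma : MeasurableSet {ω | J (pa c) ω = a} := hJ (pa c) (measurableSet_singleton a)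
  have key := h.setLIntegral_leaf hJ hJ1 hS hc hpc le_rfl (fun x => if x (pa c) = a then 1 else 0)
  simp only [restrictTo_of_mem hpc] at key
  have e1 : (fun ω => if J (pa c) ω = a then (1 : ℝ≥0∞) else 0) =
      {ω | J (pa c) ω = a}.indicator 1 := by
    ext ω; simp [Set.indicator]
  have e2 : (fun ω => ENNReal.ofReal (transition k c 1 (J (pa c) ω)) *
      if J (pa c) ω = a then (1 : ℝ≥0∞) else 0) =
      {ω | J (pa c) ω = a}.indicator fun _ => ENNReal.ofReal (transition k c 1 a) := by
    ext ω
    by_cases hω : J (pa c) ω = a <;> simp [Set.indicator, hω]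
  rw [e1, e2, lintegral_indicator_one hma, lintegral_indicator_const hma,
    Measure.restrict_apply hma] at key
  have := congrArg ENNReal.toReal key
  rwa [ENNReal.toReal_mul, ENNReal.toReal_ofReal (h.transition_nonneg _ _)] at this

/-- The transition probabilities are determined by the means and the correlation. -/
lemma transition_eq [Finite V] [IsProbabilityMeasure P]
    (h : FactorizesOn P J pa (insert c S) k)
    (hJ : ∀ v, Measurable (J v)) (hJ1 : ∀ᵐ ω ∂P, ∀ v, J v ω ≤ 1) (hS : ∀ v ∈ S, pa v ∈ S)
    (hc : c ∉ S) (hpc : pa c ∈ S) {q a : ℝ} (hq : q ∈ Set.Ioo (0 : ℝ) 1)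
    (hmean : ∀ v, ∫ ω, (J v ω : ℝ) ∂P = q)
    (hcorr : pearsonCorr (fun ω => (J (pa c) ω : ℝ)) (fun ω => (J c ω : ℝ)) P = a) :
    transition k c 1 0 = q * (1 - a) ∧ transition k c 1 1 = q * (1 - a) + a := by
  have hle v : ∀ᵐ ω ∂P, J v ω ≤ 1 := hJ1.mono fun ω hω => hω v
  have hboth := measureReal_both_eq_one (hJ (pa c)) (hJ c) (hle _) (hle _) hq (hmean _) (hmean _)
    hcorr
  have hp v : P.real {ω | J v ω = 1} = q := by
    rw [← integral_eq_measureReal_of_le_one (hJ v) (hle v), hmean]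
  have hm v b : MeasurableSet {ω | J v ω = b} := hJ v (measurableSet_singleton b)
  have hp0 : P.real {ω | J (pa c) ω = 0} = 1 - q := by
    rw [← hp (pa c), measureReal_eq_zero_of_le_one (hJ (pa c)) (hle (pa c))]
  have hsplit : P.real {ω | J c ω = 1} = P.real {ω | J (pa c) ω = 0 ∧ J c ω = 1} +
      P.real {ω | J (pa c) ω = 1 ∧ J c ω = 1} := by
    have hm1 : MeasurableSet {ω | J (pa c) ω = 1 ∧ J c ω = 1} := (hm (pa c) 1).inter (hm c 1)
    rw [← measureReal_union _ hm1]
    · refine measureReal_congr ?_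
      filter_upwards [hle (pa c)] with ω hω
      refine propext ?_
      change J c ω = 1 ↔ (J (pa c) ω = 0 ∧ J c ω = 1) ∨ (J (pa c) ω = 1 ∧ J c ω = 1)
      omega
    · rw [Set.disjoint_left]
      rintro ω ⟨h0, -⟩ ⟨h1, -⟩
      omega
  -- With `t₀`, `t₁` the transitions to `1`, total probability gives `q = t₀(1-q) + q² + aq(1-q)`,
  -- and the joint law gives `t₁q = q² + aq(1-q)`.
  rw [hp, hboth, h.measureReal_parent_leaf hJ hJ1 hS hc hpc, hp0] at hsplit
  rw [h.measureReal_parent_leaf hJ hJ1 hS hc hpc, hp] at hboth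
  have hq0 : q ≠ 0 := hq.1.ne'
  have hq1 : 1 - q ≠ 0 := by linarith [hq.2]
  constructor
  · apply mul_right_cancel₀ hq1
    linarith
  · apply mul_right_cancel₀ hq0
    linarith

end FactorizesOn

end Factorization

/-! ### Ising models on trees -/

namespace IsIsing

variable {V : Type*} [Fintype V] [DecidableEq V] {G : SimpleGraph V} [Fintype G.edgeSet]
  {Ω : Type*} [MeasurableSpace Ω] {P : Measure Ω} {J : V → Ω → ℕ}

/-- By the choice of the normalizing constant, the prescribed masses on `{0,1}^V` already sum to
`1`. -/
lemma ae_le_one [IsProbabilityMeasure P] (h : IsIsing G P J) : ∀ᵐ ω ∂P, ∀ v, J v ω ≤ 1 := by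
  obtain ⟨η₁, η₂, -, hpmf⟩ := h.pmf
  have hm (x : V → Fin 2) : MeasurableSet {ω | ∀ v, J v ω = (x v : ℕ)} := by
    have : {ω | ∀ v, J v ω = (x v : ℕ)} = ⋂ v, J v ⁻¹' {(x v : ℕ)} := by ext; simp
    rw [this]
    exact MeasurableSet.iInter fun v => h.measurable v (measurableSet_singleton _)
  have hdisj : Pairwise (Function.onFun Disjoint
      fun x : V → Fin 2 => {ω | ∀ v, J v ω = (x v : ℕ)}) := by
    intro x y hxy
    refine Set.disjoint_left.2 fun ω hx hy => hxy ?_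
    ext v
    exact (hx v).symm.trans (hy v)
  have hsum : P.real (⋃ x : V → Fin 2, {ω | ∀ v, J v ω = (x v : ℕ)}) = 1 := by
    rw [measureReal_iUnion_fintype hdisj hm]
    simp only [hpmf, Real.exp_sub, ← Finset.sum_div]
    have hpos : 0 < ∑ x : V → Fin 2, Real.exp (energy G η₁ η₂ x) :=
      Finset.sum_pos (fun _ _ => Real.exp_pos _) Finset.univ_nonempty
    rw [logPartition, Real.exp_log hpos, div_self hpos.ne']
  have hnull : P (⋃ x : V → Fin 2, {ω | ∀ v, J v ω = (x v : ℕ)})ᶜ = 0 := by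
    rw [prob_compl_eq_zero_iff (MeasurableSet.iUnion hm), ← ofReal_measureReal, hsum,
      ENNReal.ofReal_one]
  filter_upwards [measure_eq_zero_iff_ae_notMem.1 hnull] with ω hω v
  obtain ⟨x, hx⟩ := Set.mem_iUnion.1 (not_not.1 hω)
  have := hx v
  have := (x v).isLt
  omega

/-- An Ising model on a tree factorises along the tree. -/
lemma factorizesOn (h : IsIsing G P J) (hG : G.IsTree) {r : V} {pa : V → V}
    (hpa : IsParentMap G r pa) : ∃ k, FactorizesOn P J pa Finset.univ k := by
  obtain ⟨η₁, η₂, -, hpmf⟩ := h.pmf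
  -- Each interaction goes to the child endpoint of its edge; the root has no parent edge and
  -- carries the normalizing constant instead.
  refine ⟨fun v a b => Real.exp (η₁ v * b +
    if v = r then -logPartition G η₁ η₂ else η₂ s(pa v, v) * (a * b)),
    fun _ _ _ => Real.exp_pos _, fun x hx => ?_⟩
  have key := hpmf fun v => ⟨x v, Nat.lt_succ_of_le (hx v)⟩
  have hr : Finset.univ.filter (fun v => v = r) = {r} := by ext; simp
  have hr' : Finset.univ.filter (fun v => ¬ v = r) = Finset.univ.erase r := by ext; simp
  simp only [Finset.mem_univ, true_imp_iff]
  rw [key, ← Real.exp_sum, Finset.sum_add_distrib, Finset.sum_ite, hr, hr', Finset.sum_singleton,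
    energy, hpa.sum_edgeFinset hG]
  congr 1
  simp only [Sym2.map_mk, Sym2.mul_mk]
  ring

end IsIsing

/-! ### Comparison of the two fields -/

/-- Directionally convex functionals have a smaller mean under the Ising model than under the
Poisson field. -/
theorem lintegral_ising_le_mpmrf {V : Type*} [Fintype V] [DecidableEq V]
    {G : SimpleGraph V} [Fintype G.edgeSet] (hG : G.IsTree) {q : ℝ} (hq : q ∈ Set.Ioo (0 : ℝ) 1)
    {α : Sym2 V → ℝ} (hα : ∀ e ∈ G.edgeSet, α e ∈ Set.Ioo (0 : ℝ) 1)
    {Ω : Type*} [MeasurableSpace Ω] {P : Measure Ω} [IsProbabilityMeasure P]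
    {J : V → Ω → ℕ} (hJ : IsIsing G P J) (hJmean : HasMeanParams G P J (fun _ => q) α)
    {Ω' : Type*} [MeasurableSpace Ω'] {P' : Measure Ω'} [IsProbabilityMeasure P'] {r : V}
    {N L : V → Ω' → ℕ} {I : V → ℕ → Ω' → ℕ} (hN : IsMPMRFRepr G r q α P' N L I)
    {f : (V → ℕ) → ℝ≥0∞} (hf : DirectionallyConvex f) :
    ∫⁻ ω, f (fun v => J v ω) ∂P ≤ ∫⁻ ω, f (fun v => N v ω) ∂P' := by
  obtain ⟨pa, hpa⟩ := exists_isParentMap hG r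
  obtain ⟨k, hk⟩ := hJ.factorizesOn hG hpa
  have hJ1 := hJ.ae_le_one
  -- Pruning a leaf changes both the factors and the functional, so the induction is over all `k`
  -- and `f`.
  have main : ∀ k, FactorizesOn P J pa Finset.univ k → ∀ f, DirectionallyConvex f →
      ∫⁻ ω, f (restrictTo Finset.univ fun v => J v ω) ∂P ≤
        ∫⁻ ω, f (restrictTo Finset.univ fun v => N v ω) ∂P' := by
    refine hpa.induction hG (C := fun S => ∀ k, FactorizesOn P J pa S k →
      ∀ f, DirectionallyConvex f → ∫⁻ ω, f (restrictTo S fun v => J v ω) ∂P ≤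
        ∫⁻ ω, f (restrictTo S fun v => N v ω) ∂P') ?_ ?_
    · intro _ _ f hf
      have h1 : P.real {ω | J r ω = 1} = q := by
        rw [← integral_eq_measureReal_of_le_one (hJ.measurable r) (hJ1.mono fun _ h => h r),
          hJmean.mean]
      have h0 : P.real {ω | J r ω = 0} = 1 - q := by
        rw [← h1, measureReal_eq_zero_of_le_one (hJ.measurable r) (hJ1.mono fun _ h => h r)]
      simp only [restrictTo_singleton, hN.root]
      rw [lintegral_bernoulli (hJ.measurable r) h1 h0 (fun n => f (Pi.single r n)),
        ← lintegral_map (f := fun n => f (Pi.single r n)) Measurable.of_discrete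
          (hN.measurable_L r), hN.law_L_root]
      refine bernoulli_mean_le_poisson (fun m n => ?_) ?_
      · simpa using hf.single r 0 m n
      · change ENNReal.ofReal (1 - q) + ENNReal.ofReal q = 1
        rw [← ENNReal.ofReal_add (by linarith [hq.2]) hq.1.le]
        simp
    · intro S c hr hS hc hpc ih k hk f hf
      have hp := hpa.isParent c fun e => hc (e ▸ hr)
      obtain ⟨ha0, ha1⟩ := hα s(pa c, c) hp.1
      set a := α s(pa c, c) with ha
      have hq0 := hq.1
      have hq1 := hq.2
      have hqa : 0 < q * (1 - a) := mul_pos hq0 (by linarith)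
      have hqa1 : q * (1 - a) + a ≤ 1 := by nlinarith
      obtain ⟨t0, t1⟩ := hk.transition_eq hJ.measurable hJ1 hS hc hpc hq hJmean.mean
        (hJmean.corr _ _ hp.1)
      have s0 := hk.transition_zero_add_one 0
      have s1 := hk.transition_zero_add_one 1
      have n0 := hk.transition_nonneg 0 0
      have n1 := hk.transition_nonneg 0 1
      have hab : ENNReal.ofReal (1 - a) + ENNReal.ofReal a = 1 := by
        rw [← ENNReal.ofReal_add (by linarith) ha0.le]; simp
      rw [hk.lintegral_restrictTo_insert hJ.measurable hJ1 hS hc hpc,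
        hN.lintegral_restrictTo_insert hG hpa hr hS hc hpc]
      -- The leaf is compared given the Ising configuration on `S`; the induction hypothesis then
      -- replaces the field on `S`.
      refine le_trans (lintegral_mono_ae ?_)
        (ih _ (hk.marginal hJ.measurable hJ1 hS hc hpc) _ (hf.offspringMean hab _ _ _))
      filter_upwards [hJ1] with ω hω
      rcases Nat.le_one_iff_eq_zero_or_eq_one.1 (hω (pa c)) with e | e
      · rw [e, t0]
        refine two_point_le_offspringMean_zero ?_ hf (by rw [restrictTo_of_mem hpc, e])
        change _ + ENNReal.ofReal _ = 1
        rw [← ENNReal.ofReal_add n0 hqa.le, ← t0, s0, ENNReal.ofReal_one]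
      · rw [e, t1, ENNReal.ofReal_add hqa.le ha0.le]
        refine two_point_le_offspringMean_one hab ?_ hf (by rw [restrictTo_of_mem hpc, e])
        change _ + ENNReal.ofReal _ + _ = 1
        rw [← ENNReal.ofReal_add n1 hqa.le, ← ENNReal.ofReal_add (add_nonneg n1 hqa.le) ha0.le,
          add_assoc, ← t1, s1, ENNReal.ofReal_one]
  simpa only [restrictTo_univ] using main k hk f hf

/-! ### From directionally convex functionals to the convex order -/

section ConvexFunctions

variable {φ : ℝ → ℝ}

/-- The points `s + u` and `s + v` are convex combinations of `s` and `s + u + v` with interchanged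
weights; the two convexity inequalities are added. -/
lemma ConvexOn.add_le_add_of_nonneg (hφ : ConvexOn ℝ Set.univ φ) (s : ℝ) {u v : ℝ} (hu : 0 ≤ u)
    (hv : 0 ≤ v) : φ (s + u) + φ (s + v) ≤ φ (s + u + v) + φ s := by
  rcases eq_or_lt_of_le (add_nonneg hu hv) with h | h
  · have hu0 : u = 0 := by linarith
    have hv0 : v = 0 := by linarith
    simp [hu0, hv0]
  · have hw : v / (u + v) + u / (u + v) = 1 := by field_simp; ring
    have h1 := hφ.2 (Set.mem_univ s) (Set.mem_univ (s + u + v)) (div_nonneg hv h.le)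
      (div_nonneg hu h.le) hw
    have h2 := hφ.2 (Set.mem_univ s) (Set.mem_univ (s + u + v)) (div_nonneg hu h.le)
      (div_nonneg hv h.le) (by rw [add_comm, hw])
    simp only [smul_eq_mul] at h1 h2
    have e1 : v / (u + v) * s + u / (u + v) * (s + u + v) = s + u := by field_simp; ring
    have e2 : u / (u + v) * s + v / (u + v) * (s + u + v) = s + v := by field_simp; ring
    rw [e1] at h1
    rw [e2] at h2
    have e3 : φ (s + u + v) + φ s = (v / (u + v) + u / (u + v)) * (φ (s + u + v) + φ s) := by
      rw [hw, one_mul]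
    rw [e3]
    linarith

/-- The function `φ` minus the chord of `φ` through `-1` and `0`. -/
def subChord (φ : ℝ → ℝ) (x : ℝ) : ℝ := φ x - (φ 0 + (φ 0 - φ (-1)) * x)

/-- Beyond its end `0`, the chord extended to `x ≥ 0` lies below `φ`: `0` is the combination of `-1`
and `x` with weights `x / (x + 1)` and `1 / (x + 1)`. -/
lemma subChord_nonneg (hφ : ConvexOn ℝ Set.univ φ) {x : ℝ} (hx : 0 ≤ x) : 0 ≤ subChord φ x := by
  have ha : 0 ≤ x / (x + 1) := by positivity
  have hb : 0 ≤ 1 / (x + 1) := by positivity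
  have h := hφ.2 (Set.mem_univ (-1)) (Set.mem_univ x) ha hb (by field_simp)
  simp only [smul_eq_mul] at h
  have e : x / (x + 1) * -1 + 1 / (x + 1) * x = 0 := by field_simp; ring
  have e' : x / (x + 1) * φ (-1) + 1 / (x + 1) * φ x = (x * φ (-1) + φ x) / (x + 1) := by ring
  rw [e, e', le_div_iff₀ (by positivity)] at h
  unfold subChord
  linarith

/-- The affine part contributes equally to both sides, and nonnegativity lets `ENNReal.ofReal`
commute with the additions. -/
lemma directionallyConvex_ofReal_subChord_sum {V : Type*} [Fintype V]
    (hφ : ConvexOn ℝ Set.univ φ) :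
    DirectionallyConvex fun x : V → ℕ => ENNReal.ofReal (subChord φ (∑ v, (x v : ℝ))) := by
  intro x a b
  have nn (y : V → ℕ) : 0 ≤ ∑ v, (y v : ℝ) := Finset.sum_nonneg fun _ _ => Nat.cast_nonneg _
  have h (y : V → ℕ) := subChord_nonneg hφ (nn y)
  beta_reduce
  rw [← ENNReal.ofReal_add (h _) (h _), ← ENNReal.ofReal_add (h _) (h _)]
  refine ENNReal.ofReal_le_ofReal ?_
  have := ConvexOn.add_le_add_of_nonneg hφ (∑ v, (x v : ℝ)) (nn a) (nn b)
  simp only [subChord, Pi.add_apply, Nat.cast_add, Finset.sum_add_distrib]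
  linarith

end ConvexFunctions

lemma integrable_of_ofReal_parts {Ω : Type*} [MeasurableSpace Ω] {P : Measure Ω} {g : Ω → ℝ}
    (hg : AEMeasurable g P) (h₁ : ∫⁻ ω, ENNReal.ofReal (g ω) ∂P ≠ ⊤)
    (h₂ : ∫⁻ ω, ENNReal.ofReal (-g ω) ∂P ≠ ⊤) : Integrable g P := by
  refine ⟨hg.aestronglyMeasurable, ?_⟩
  calc ∫⁻ ω, ‖g ω‖ₑ ∂P
      ≤ ∫⁻ ω, (ENNReal.ofReal (g ω) + ENNReal.ofReal (-g ω)) ∂P := by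
        refine lintegral_mono fun ω => ?_
        rw [Real.enorm_eq_ofReal_abs]
        rcases abs_cases (g ω) with ⟨e, -⟩ | ⟨e, -⟩ <;> rw [e]
        · exact le_self_add
        · exact le_add_self
    _ = _ := lintegral_add_left' hg.ennreal_ofReal _
    _ < ⊤ := ENNReal.add_lt_top.2 ⟨h₁.lt_top, h₂.lt_top⟩

/-- Two nonnegative variables with the same mean are ordered in the convex order as soon as the
nonnegative functions `subChord φ` are ordered. -/
lemma convexOrderLE_of_lintegral_subChord_le {Ω Ω' : Type*} [MeasurableSpace Ω]
    [MeasurableSpace Ω'] {P : Measure Ω} [IsProbabilityMeasure P] {P' : Measure Ω'}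
    [IsProbabilityMeasure P'] {X : Ω → ℝ} {Y : Ω' → ℝ} (hX : Integrable X P) (hY : Integrable Y P')
    (hX0 : ∀ ω, 0 ≤ X ω) (hY0 : ∀ ω, 0 ≤ Y ω) (hmean : ∫ ω, X ω ∂P = ∫ ω, Y ω ∂P')
    (H : ∀ φ, ConvexOn ℝ Set.univ φ → ∫⁻ ω, ENNReal.ofReal (subChord φ (X ω)) ∂P ≤
      ∫⁻ ω, ENNReal.ofReal (subChord φ (Y ω)) ∂P') : ConvexOrderLE X P Y P' := by
  intro φ hφ hφX hφY
  set b := φ 0 - φ (-1) with hb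
  have lX : Integrable (fun ω => φ 0 + b * X ω) P := (integrable_const _).add (hX.const_mul b)
  have lY : Integrable (fun ω => φ 0 + b * Y ω) P' := (integrable_const _).add (hY.const_mul b)
  have eX (ω) : φ (X ω) = subChord φ (X ω) + (φ 0 + b * X ω) := by rw [subChord]; ring
  have eY (ω) : φ (Y ω) = subChord φ (Y ω) + (φ 0 + b * Y ω) := by rw [subChord]; ring
  have mX : AEMeasurable (fun ω => subChord φ (X ω)) P := hφX.1.sub lX.aemeasurable
  by_cases hint : Integrable (fun ω => φ (Y ω)) P'
  · have gY : Integrable (fun ω => subChord φ (Y ω)) P' := hint.sub lY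
    have hne : ∫⁻ ω, ENNReal.ofReal (subChord φ (Y ω)) ∂P' ≠ ⊤ := gY.lintegral_lt_top.ne
    have gX : Integrable (fun ω => subChord φ (X ω)) P := by
      refine integrable_of_ofReal_parts mX (ne_top_of_le_ne_top hne (H φ hφ)) ?_
      have : ∀ ω, ENNReal.ofReal (-subChord φ (X ω)) = 0 := fun ω =>
        ENNReal.ofReal_of_nonpos (neg_nonpos.2 (subChord_nonneg hφ (hX0 ω)))
      simp [this]
    have hintX : Integrable (fun ω => φ (X ω)) P := by
      simp only [eX]; exact gX.add lX
    rw [expectation_eq_integral hintX, expectation_eq_integral hint, EReal.coe_le_coe_iff]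
    simp only [eX, eY]
    rw [integral_add gX lX, integral_add gY lY]
    have hl : ∫ ω, (φ 0 + b * X ω) ∂P = ∫ ω, (φ 0 + b * Y ω) ∂P' := by
      rw [integral_add (integrable_const _) (hX.const_mul b),
        integral_add (integrable_const _) (hY.const_mul b), integral_const_mul,
        integral_const_mul, hmean]
      simp
    rw [hl, integral_eq_lintegral_of_nonneg_ae (.of_forall fun ω => subChord_nonneg hφ (hX0 ω))
      gX.aestronglyMeasurable, integral_eq_lintegral_of_nonneg_ae
      (.of_forall fun ω => subChord_nonneg hφ (hY0 ω)) gY.aestronglyMeasurable]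
    gcongr
    exact H φ hφ
  -- Above an integrable affine function of `Y`, `φ(Y)` has a negative part of finite mean; if it is
  -- not integrable, its expectation is `+∞`.
  · have hneg : ∫⁻ ω, ENNReal.ofReal (-φ (Y ω)) ∂P' ≠ ⊤ := by
      refine ne_top_of_le_ne_top lY.neg.lintegral_lt_top.ne (lintegral_mono fun ω => ?_)
      refine ENNReal.ofReal_le_ofReal (neg_le_neg ?_)
      rw [eY]
      linarith [subChord_nonneg hφ (hY0 ω)]
    have hpos : ∫⁻ ω, ENNReal.ofReal (φ (Y ω)) ∂P' = ⊤ := by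
      by_contra hne
      exact hint (integrable_of_ofReal_parts hφY.1 hne hneg)
    have htop : expectation (fun ω => φ (Y ω)) P' = ⊤ := by
      rw [expectation, hpos, EReal.coe_ennreal_top]
      lift ∫⁻ ω, ENNReal.ofReal (-φ (Y ω)) ∂P' to NNReal using hneg with c
      exact EReal.top_sub_coe c
    rw [htop]
    exact le_top

lemma integrable_natCast_and_integral_eq {Ω : Type*} [MeasurableSpace Ω] {P : Measure Ω}
    {X : Ω → ℕ} (hX : AEMeasurable X P) {q : ℝ} (hq : 0 ≤ q)
    (h : ∫⁻ ω, (X ω : ℝ≥0∞) ∂P = ENNReal.ofReal q) :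
    Integrable (fun ω => (X ω : ℝ)) P ∧ ∫ ω, (X ω : ℝ) ∂P = q := by
  have hm : AEMeasurable (fun ω => (X ω : ℝ)) P := measurable_from_top.comp_aemeasurable hX
  have h' : ∫⁻ ω, ENNReal.ofReal (X ω : ℝ) ∂P = ENNReal.ofReal q := by simpa using h
  refine ⟨integrable_of_ofReal_parts hm (h' ▸ ENNReal.ofReal_ne_top) ?_, ?_⟩
  · have : ∀ ω, ENNReal.ofReal (-(X ω : ℝ)) = 0 := fun ω =>
      ENNReal.ofReal_of_nonpos (neg_nonpos.2 (Nat.cast_nonneg _))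
    simp [this]
  · rw [integral_eq_lintegral_of_nonneg_ae (.of_forall fun ω => Nat.cast_nonneg _)
      hm.aestronglyMeasurable, h', ENNReal.toReal_ofReal hq]


end IsingPoisson

end

-- The convex order between the two sums

theorem theorem5 {V : Type*} [Fintype V] [DecidableEq V]
    (G : SimpleGraph V) [DecidableRel G.Adj] (hG : G.IsTree)
    (q : ℝ) (hq : q ∈ Set.Ioo (0 : ℝ) 1)
    (α : Sym2 V → ℝ) (hα : ∀ e ∈ G.edgeSet, α e ∈ Set.Ioo (0 : ℝ) 1)
    {Ω : Type*} [MeasurableSpace Ω] (P : Measure Ω) [IsProbabilityMeasure P]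
    (J : V → Ω → ℕ) (hJ : IsingPoisson.IsIsing G P J)
    (hJmean : IsingPoisson.HasMeanParams G P J (fun _ => q) α)
    {Ω' : Type*} [MeasurableSpace Ω'] (P' : Measure Ω') [IsProbabilityMeasure P']
    (N : V → Ω' → ℕ) (hN : IsingPoisson.IsMPMRF G q α P' N) :
    IsingPoisson.ConvexOrderLE
      (fun ω => ∑ v, (J v ω : ℝ)) P (fun ω => ∑ v, (N v ω : ℝ)) P' := by
  obtain ⟨r, Ω₀, _, P₀, _, N₀, L, I, hrepr, hident⟩ := hN
  have hNm (v : V) : AEMeasurable (N v) P' :=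
    (measurable_pi_apply v).comp_aemeasurable hident.aemeasurable_fst
  -- Only the law of `N` is prescribed, so its means and functionals are computed on the space of
  -- the stochastic representation.
  have transfer (f : (V → ℕ) → ENNReal) :
      ∫⁻ ω, f (fun v => N v ω) ∂P' = ∫⁻ ω, f (fun v => N₀ v ω) ∂P₀ :=
    (hident.comp (Measurable.of_discrete (f := f))).lintegral_eq
  have hNmean (v : V) := IsingPoisson.integrable_natCast_and_integral_eq (hNm v) hq.1.le
    ((transfer fun x => (x v : ENNReal)).trans (hrepr.lintegral_eq hG hq.1.le hα v))
  have hJint (v : V) : Integrable (fun ω => (J v ω : ℝ)) P :=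
    (IsingPoisson.memLp_of_le_one (hJ.measurable v)
      (hJ.ae_le_one.mono fun _ h => h v)).integrable one_le_two
  refine IsingPoisson.convexOrderLE_of_lintegral_subChord_le
    (integrable_finsetSum _ fun v _ => hJint v)
    (integrable_finsetSum _ fun v _ => (hNmean v).1)
    (fun ω => Finset.sum_nonneg fun _ _ => Nat.cast_nonneg _)
    (fun ω => Finset.sum_nonneg fun _ _ => Nat.cast_nonneg _) ?_ fun φ hφ => ?_
  · rw [integral_finsetSum _ fun v _ => hJint v,
      integral_finsetSum _ fun v _ => (hNmean v).1]
    exact Finset.sum_congr rfl fun v _ => (hJmean.mean v).trans (hNmean v).2.symm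
  · have hconv := IsingPoisson.directionallyConvex_ofReal_subChord_sum (V := V) hφ
    exact (IsingPoisson.lintegral_ising_le_mpmrf hG hq hα hJ hJmean hrepr hconv).trans
      (transfer fun x => ENNReal.ofReal (IsingPoisson.subChord φ (∑ v, (x v : ℝ)))).ge
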